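/- Let $\lambda,c,r,\mu,\sigma,a,b>0$ and let $F$ be a distribution on $(0,\infty)$ with finite mean and with a density $f$ that is continuous on $[0,\infty)$ (so $F'(0+)=f(0)$). For a function $W$ on $(0,\infty)$, $\theta\in\mathbb R$ and $x>0$ put $$M(W)(x)=\lambda\Big[W(x)-\int_0^xW(x-s)\,dF(s)\Big],$$ $$\mathcal L^{(\theta)}W(x)=\tfrac{\sigma^2x^2\theta^2}{2}W''(x)+[c+rx+(\mu-r)\theta x]W'(x)-M(W)(x),$$ $$\alpha_W(x)=-\frac{(\mu-r)W'(x)}{\sigma^2xW''(x)}\ \ (W''(x)\ne0),\qquad \phi_W(x)=\frac{2[M(W)(x)-(c+rx)W'(x)]}{(\mu-r)xW'(x)}\ \ (\mu\neq r,\ W'(x)>0).$$ Let $\alpha^*_W(x)$ be * $\alpha_W(x)$ if $W''(x)<0$ and $-b\le\alpha_W(x)\le a$; * $a$ if $W''(x)<0$ and $\alpha_W(x)>a$, or $W''(x)>0$ and $\alpha_W(x)\le\frac{a-b}2$, or $W''(x)=0$ and $\mu\ge r$; * $-b$ if $W''(x)<0$ and $\alpha_W(x)<-b$, or $W''(x)>0$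 and $\alpha_W(x)>\frac{a-b}2$, or $W''(x)=0$ and $\mu<r$. For $\gamma\in[-b,a]$, say that $W$ solves the HJB equation at $x$ with maximizer $\gamma$ if $\sup_{\theta\in[-b,a]}\mathcal L^{(\theta)}W(x)=\mathcal L^{(\gamma)}W(x)=0$. Assume $\mu>r$. Define $V$ on $(0,\infty)$ as follows. Let $V_a$ be a $C^2$ function on $(0,\infty)$ with $\mathcal L^{(a)}V_a=0$ on $(0,\infty)$, $V_a(0+)=1$, $V_a'(0+)=\lambda/c$ and $V_a''(0+)=\frac\lambda c\big(\frac\lambda c-F'(0+)-\frac{r+a(\mu-r)}c\big)$, and let $\varepsilon>0$ be such that $V_a$ solves the HJB equation with maximizer $a$ at every point of $(0,\varepsilon)$. For every integer $n\ge2$ let $w_n$ be a solution on $[\varepsilon,\infty)$ of $$w_n'(x)=2\inf_{\theta\in[-b,a],\ |\theta|>\min(a,b)/n}\frac{M(V^{(n)})(x)-[c+rx+\theta x(\mu-r)]w_n(x)}{\theta^2\sigma^2x^2},\qquad w_n(\varepsilon)=V_a'(\varepsilon),$$ where $V^{(n)}=V_a$ on $(0,\varepsilon]$ and $V^{(n)}(x)=V_a(\varepsilon)+\int_\varepsilon^xw_n(y)\,dy$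 for $x>\varepsilon$. Let $V(x)=\lim_{n\to\infty}V^{(n)}(x)$ for $x>0$. **Theorem.** Let $\mu>r$ and $a<b$. Then the construction can be carried out (suitable $V_a$, $\varepsilon$, $w_n$ exist, and the limit exists for every $x>0$), and every $V$ that arises from it is twice continuously differentiable on $(0,\infty)$ with $V'>0$ and has the following properties. (i) If $x>0$ and $\phi_V(x)<a$, then $V''(x)\neq0$ and $V$ solves the HJB equation at $x$ with maximizer $\alpha_V(x)$. If $a<\phi_V(x)<\frac{2ab}{b-a}$, then $V$ solves it at $x$ with maximizer $a$. If $\phi_V(x)>\frac{2ab}{b-a}$, then $V$ solves it at $x$ with maximizer $-b$. (ii) For every $x>0$, $V$ solves the HJB equation at $x$ with maximizer $\alpha_V^*(x)$, and $$\alpha_V^*(x)=\begin{cases}\alpha_V(x)=\phi_V(x)&\text{if }\phi_V(x)<a,\\ a&\text{if }a\le\phi_V(x)\le\frac{2ab}{b-a},\\ -b&\text{if }\phi_V(x)>\frac{2ab}{b-a};\end{cases}$$ moreover $\phi_V(x)>0$ for every $x>0$. -/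

import Mathlib

open Set Filter Topology MeasureTheory

noncomputable section

namespace ConstrainedInvestment

/-- Parameters of the model: claim intensity `lam`, premium rate `c`, interest rate `r`, stock
return `μ`, volatility `σ`, bound `a` on the long position and `b` on the short position (as
proportions of the surplus), and the density `f` of the claim size distribution `F` on `(0,∞)`.
The value `f 0` is the right derivative `F'(0+)`; the values of `f` on `(-∞,0)` play no role. -/
structure Model where
  lam : ℝ
  c : ℝ
  r : ℝ
  μ : ℝ
  σ : ℝ
  a : ℝ
  b : ℝ
  f : ℝ → ℝ
  lam_pos : 0 < lam
  c_pos : 0 < c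
  r_pos : 0 < r
  μ_pos : 0 < μ
  σ_pos : 0 < σ
  a_pos : 0 < a
  b_pos : 0 < b
  f_cont : ContinuousOn f (Ici 0)
  f_nonneg : ∀ x, 0 < x → 0 ≤ f x
  f_integrable : IntegrableOn f (Ioi 0)
  f_integral : ∫ x in Ioi 0, f x = 1
  f_mean : IntegrableOn (fun x => x * f x) (Ioi 0)

namespace Model

variable (P : Model)

/-- `M(W)(x) = λ [W(x) - ∫₀ˣ W(x-s) dF(s)]`. -/
def M (W : ℝ → ℝ) (x : ℝ) : ℝ :=
  P.lam * (W x - ∫ s in (0 : ℝ)..x, W (x - s) * P.f s)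

/-- The operator `𝓛^(θ) W(x) = σ²x²θ²/2 W''(x) + [c + r x + (μ - r) θ x] W'(x) - M(W)(x)`. -/
def L (θ : ℝ) (W : ℝ → ℝ) (x : ℝ) : ℝ :=
  P.σ ^ 2 * x ^ 2 * θ ^ 2 / 2 * deriv (deriv W) x
    + (P.c + P.r * x + (P.μ - P.r) * θ * x) * deriv W x - P.M W x

/-- `sup_{θ ∈ [-b,a]} 𝓛^(θ) W(x) = 𝓛^(γ) W(x) = 0`: the HJB equation holds for `W` at `x`, and
its supremum over `[-b,a]` is attained at `γ ∈ [-b,a]`. -/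
def SolvesHJBWith (γ : ℝ) (W : ℝ → ℝ) (x : ℝ) : Prop :=
  γ ∈ Icc (-P.b) P.a ∧ IsMaxOn (fun θ => P.L θ W x) (Icc (-P.b) P.a) γ ∧ P.L γ W x = 0

/-- The vertex `α_W(x) = -(μ - r) W'(x) / (σ² x W''(x))` (meaningful when `W''(x) ≠ 0`). -/
def alpha (W : ℝ → ℝ) (x : ℝ) : ℝ :=
  -((P.μ - P.r) * deriv W x) / (P.σ ^ 2 * x * deriv (deriv W) x)

open Classical in
/-- The maximizer `α*_W(x)`, by cases on the sign of `W''(x)` and the position of the vertex. -/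
def alphaStar (W : ℝ → ℝ) (x : ℝ) : ℝ :=
  if deriv (deriv W) x < 0 then
    if P.a < P.alpha W x then P.a
    else if P.alpha W x < -P.b then -P.b
    else P.alpha W x
  else if 0 < deriv (deriv W) x then
    if P.alpha W x ≤ (P.a - P.b) / 2 then P.a else -P.b
  else
    if P.r ≤ P.μ then P.a else -P.b

/-- `φ_W(x) = 2 [M(W)(x) - (c + r x) W'(x)] / ((μ - r) x W'(x))`. -/
def phi (W : ℝ → ℝ) (x : ℝ) : ℝ :=
  2 * (P.M W x - (P.c + P.r * x) * deriv W x) / ((P.μ - P.r) * x * deriv W x)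

/-- `V_γ`: a `C²` function on `(0,∞)` solving `𝓛^(γ) V_γ = 0` there, with the prescribed values
of `V_γ(0+)`, `V_γ'(0+)` and `V_γ''(0+)`. -/
structure IsVgamma (γ : ℝ) (W : ℝ → ℝ) : Prop where
  contDiffOn : ContDiffOn ℝ 2 W (Ioi 0)
  eqn : ∀ x, 0 < x → P.L γ W x = 0
  zero : Tendsto W (𝓝[>] 0) (𝓝 1)
  deriv_zero : Tendsto (deriv W) (𝓝[>] 0) (𝓝 (P.lam / P.c))
  deriv_deriv_zero : Tendsto (deriv (deriv W)) (𝓝[>] 0)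
    (𝓝 (P.lam / P.c * (P.lam / P.c - P.f 0 - (P.r + γ * (P.μ - P.r)) / P.c)))

open Classical in
/-- The function equal to `G` on `(0,ε]` and to `G(ε) + ∫_ε^x w(y) dy` for `x > ε`. -/
def extend (G : ℝ → ℝ) (ε : ℝ) (w : ℝ → ℝ) (x : ℝ) : ℝ :=
  if x ≤ ε then G x else G ε + ∫ y in ε..x, w y

/-- The operator `T` with cut-off level `A`:
`T w(x) = 2 inf {M(W)(x) - [c + r x + θ x (μ - r)] w(x)} / (θ² σ² x²)` over
`θ ∈ [-b,a]`, `|θ| > A`, where `W` extends `G` beyond `ε` by integrating `w`. -/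
def T (A : ℝ) (G : ℝ → ℝ) (ε : ℝ) (w : ℝ → ℝ) (x : ℝ) : ℝ :=
  2 * sInf ((fun θ => (P.M (extend G ε w) x
      - (P.c + P.r * x + θ * x * (P.μ - P.r)) * w x) / (θ ^ 2 * P.σ ^ 2 * x ^ 2)) ''
    {θ | θ ∈ Icc (-P.b) P.a ∧ A < |θ|})

/-- `w` solves `w'(x) = T w(x)` on `[ε,∞)` with `w(ε) = G'(ε)`. -/
def SolvesT (A : ℝ) (G : ℝ → ℝ) (ε : ℝ) (w : ℝ → ℝ) : Prop :=
  w ε = deriv G ε ∧ ∀ x, ε ≤ x → HasDerivWithinAt w (P.T A G ε w x) (Ici ε) x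

/-- `V` is the function on `(0,∞)` constructed for `μ > r`: with `V_a` and `ε > 0` such that `V_a`
solves the HJB equation with maximizer `a` on `(0,ε)`, and with `V⁽ⁿ⁾` the extension of `V_a`
beyond `ε` by the solution of `w' = T w` for the cut-off level `min(a,b)/n`, it is
`V = lim V⁽ⁿ⁾`. (The cut-off level must lie below `min(a,b)`, hence `n ≥ 2`.) -/
def IsV (V : ℝ → ℝ) : Prop :=
  ∃ (Va : ℝ → ℝ) (ε : ℝ) (w : ℕ → ℝ → ℝ),
    P.IsVgamma P.a Va ∧
    0 < ε ∧
    (∀ x ∈ Ioo 0 ε, P.SolvesHJBWith P.a Va x) ∧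
    (∀ n : ℕ, 2 ≤ n → P.SolvesT (min P.a P.b / n) Va ε (w n)) ∧
    ∀ x, 0 < x → Tendsto (fun n => extend Va ε (w n) x) atTop (𝓝 (V x))

end Model

end ConstrainedInvestment

end

/-! Everything is expressed through `w = V'`. Since `V(0+) = 1`, integration by parts turns `M(V)`
into the Volterra functional `MD w` (`M_eq_MD`). At a fixed `x` put `D = M(V) - (c + r x) w`, `E =
(μ - r) x w` and `z = σ² x² w' / 2`; the HJB equation says that `z θ² + E θ - D` has maximum `0`
over `[-b,a]`. If `D > 0`, this means that `z` is the minimum of `D/θ² - E/θ` over the nonzero `θ`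
in `[-b,a]`. For `D, E > 0` that function decreases in `|θ|` for negative `θ` and decreases on `(0,
2D/E]`, so discarding `|θ| ≤ A` changes nothing as long as `A E ≤ 2 D` (`isHJBValue_J`).

The cut-off makes the first-order equation for `w` Lipschitz on `[ε,∞)`, and a contraction in an
exponentially weighted norm solves it; a similar weight gives uniqueness. The crux is
`exists_apriori_bound`: on `[ε,N]`, barriers that do not depend on the cut-off keep `w` between two
positive exponentials and `D` above a positive constant, so `A E ≤ 2 D` for every small `A`.
Solutions for all small cut-offs therefore solve the same equation and coincide on `[ε,N]`
(`exists_stable`). At each `x` the sequence `V⁽ⁿ⁾(x)` is eventually constant, and `V` inherits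
regularity and the HJB equation.

The starting function `V_a` solves an equation that is singular at `0`. An integrating factor
rewrites it as a fixed-point problem for weighted averages (`exists_isVgamma`).

The final classification is pointwise algebra (`IsHJBValue.maximizer`). The critical point of `D/θ²
- E/θ` is `2D/E = φ`. If `φ < a` the minimum is there; otherwise it is at an endpoint, and comparing
`(D - E a)/a²` with `(D + E b)/b²` produces the threshold `2ab/(b-a)`. -/

namespace ConstrainedInvestment

noncomputable section

/-! ### Convolutions with a smooth kernel. -/

/-- Differentiation of a convolution against a `C¹` kernel vanishing at `0`. -/
theorem hasDerivAt_convolution {w G g : ℝ → ℝ} (hw : Continuous w)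
    (hG : ∀ x, HasDerivAt G (g x) x) (hg : Continuous g) (h0 : G 0 = 0) (x : ℝ) :
    HasDerivAt (fun x => ∫ s in (0 : ℝ)..x, w s * G (x - s))
      (∫ s in (0 : ℝ)..x, w s * g (x - s)) x := by
  have hGc : Continuous G := continuous_iff_continuousAt.2 fun x => (hG x).continuousAt
  have hi : ∀ y a b, IntervalIntegrable (fun s => w s * G (y - s)) volume a b := fun y a b =>
    (hw.mul (hGc.comp (continuous_const.sub continuous_id))).intervalIntegrable _ _
  have hA : HasDerivAt (fun y => ∫ s in (0 : ℝ)..x, w s * G (y - s))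
      (∫ s in (0 : ℝ)..x, w s * g (x - s)) x := by
    have hc : ContinuousOn (fun p : ℝ × ℝ => w p.2 * g (p.1 - p.2))
        (Icc (x - 1) (x + 1) ×ˢ uIcc 0 x) := by fun_prop
    obtain ⟨C, hC⟩ := (isCompact_Icc.prod isCompact_uIcc).exists_bound_of_continuousOn hc
    refine (intervalIntegral.hasDerivAt_integral_of_dominated_loc_of_deriv_le
      (F' := fun y s => w s * g (y - s)) (bound := fun _ => C)
      (Icc_mem_nhds (by linarith : x - 1 < x) (by linarith : x < x + 1))
      (Eventually.of_forall fun y => ?_) (hi _ _ _) ?_ ?_ ?_ ?_).2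
    · exact (hw.mul (hGc.comp (continuous_const.sub continuous_id))).aestronglyMeasurable
    · exact (hw.mul (hg.comp (continuous_const.sub continuous_id))).aestronglyMeasurable
    · exact Eventually.of_forall fun s hs y hy => hC (y, s) ⟨hy, uIoc_subset_uIcc hs⟩
    · simp
    · refine Eventually.of_forall fun s hs y hy => ?_
      have := (hG (y - s)).comp y ((hasDerivAt_id y).sub_const s)
      simpa using this.const_mul (w s)
  -- The moving endpoint contributes nothing to first order, because `G` is small near `0`.
  have hB : HasDerivAt (fun y => ∫ s in x..y, w s * G (y - s)) 0 x := by
    rw [hasDerivAt_iff_isLittleO, Asymptotics.isLittleO_iff]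
    intro c hc
    have hcont : ContinuousAt (fun p : ℝ × ℝ => w p.2 * G (p.1 - p.2)) (x, x) := by fun_prop
    have := Metric.continuousAt_iff.1 hcont c hc
    obtain ⟨δ, hδ, hball⟩ := this
    filter_upwards [Metric.ball_mem_nhds x hδ] with y hy
    simp only [intervalIntegral.integral_same, sub_zero, smul_zero]
    refine intervalIntegral.norm_integral_le_of_norm_le_const fun s hs => ?_
    have hsy : dist s x < δ := by
      have h1 : |s - x| ≤ |y - x| := abs_sub_left_of_mem_uIcc (uIoc_subset_uIcc hs)
      rw [Real.dist_eq]
      rw [Metric.mem_ball, Real.dist_eq] at hy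
      linarith
    have := @hball (y, s) (by simpa [Prod.dist_eq] using ⟨hy, hsy⟩)
    simp only [sub_self, h0, mul_zero, dist_zero_right] at this
    exact this.le
  have := hA.add hB
  rw [add_zero] at this
  refine this.congr_of_eventuallyEq (Eventually.of_forall fun y => ?_)
  simp only [Pi.add_apply]
  exact (intervalIntegral.integral_add_adjacent_intervals (hi y 0 x) (hi y x y)).symm

theorem continuous_convolution {w g : ℝ → ℝ} (hw : Continuous w) (hg : Continuous g) :
    Continuous fun x => ∫ s in (0 : ℝ)..x, w s * g (x - s) := by
  have h : Continuous (Function.uncurry fun x s : ℝ => w s * g (x - s)) := by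
    simp only [Function.uncurry_def]; fun_prop
  exact (intervalIntegral.continuous_parametric_primitive_of_continuous (μ := volume)
    (a₀ := 0) h).comp (continuous_id.prodMk continuous_id)

/-! ### The operator `M` as a functional of the derivative. -/

namespace Model

variable (P : Model)

/-- The claim density, extended continuously to the whole line. -/
def density (x : ℝ) : ℝ := P.f (max x 0)

/-- The tail `1 - F` of the claim size distribution. -/
def tail (x : ℝ) : ℝ := 1 - ∫ s in (0 : ℝ)..x, P.density s

/-- `M(W)` in terms of `w = W'` when `W(0+) = 1`. -/
def MD (w : ℝ → ℝ) (x : ℝ) : ℝ :=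
  P.lam * (P.tail x + ∫ s in (0 : ℝ)..x, w s * P.tail (x - s))

theorem continuous_density : Continuous P.density :=
  P.f_cont.comp_continuous (continuous_id.max continuous_const) fun _ => mem_Ici.2 (le_max_right _ _)

theorem density_of_nonneg {x : ℝ} (hx : 0 ≤ x) : P.density x = P.f x := by
  rw [density, max_eq_left hx]

theorem hasDerivAt_tail (x : ℝ) : HasDerivAt P.tail (-P.density x) x := by
  have := (P.continuous_density.integral_hasStrictDerivAt 0 x).hasDerivAt.const_sub 1
  exact this

theorem continuous_tail : Continuous P.tail :=
  continuous_iff_continuousAt.2 fun x => (P.hasDerivAt_tail x).continuousAt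

@[simp] theorem tail_zero : P.tail 0 = 1 := by simp [tail]

theorem integral_density {x : ℝ} (hx : 0 ≤ x) :
    ∫ s in (0 : ℝ)..x, P.density s = ∫ s in Ioc 0 x, P.f s := by
  rw [intervalIntegral.integral_of_le hx]
  exact setIntegral_congr_fun measurableSet_Ioc fun s hs => P.density_of_nonneg hs.1.le

theorem tail_nonneg {x : ℝ} (hx : 0 ≤ x) : 0 ≤ P.tail x := by
  rw [tail, P.integral_density hx, sub_nonneg, ← P.f_integral]
  exact setIntegral_mono_set P.f_integrable
    ((ae_restrict_iff' measurableSet_Ioi).2 (Eventually.of_forall fun s hs => P.f_nonneg s hs))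
    Ioc_subset_Ioi_self.eventuallyLE

theorem tail_le_one {x : ℝ} (hx : 0 ≤ x) : P.tail x ≤ 1 := by
  rw [tail, P.integral_density hx, sub_le_self_iff]
  exact setIntegral_nonneg measurableSet_Ioc fun s hs => P.f_nonneg s hs.1

/-- The tail equals `1` at `0`, so the convolution rule is applied to `1 - tail`; the remaining `∫
w` is a plain primitive. -/
theorem hasDerivAt_MD {w : ℝ → ℝ} (hw : Continuous w) (x : ℝ) :
    HasDerivAt (P.MD w)
      (P.lam * (w x - P.density x - ∫ s in (0 : ℝ)..x, w s * P.density (x - s))) x := by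
  have h1 : HasDerivAt (fun x => ∫ s in (0 : ℝ)..x, w s * (1 - P.tail (x - s)))
      (∫ s in (0 : ℝ)..x, w s * P.density (x - s)) x :=
    hasDerivAt_convolution (G := fun x => 1 - P.tail x) hw
      (fun y => by simpa using (P.hasDerivAt_tail y).const_sub 1) P.continuous_density
      (by simp) x
  have h2 : HasDerivAt (fun x => ∫ s in (0 : ℝ)..x, w s) (w x) x :=
    (hw.integral_hasStrictDerivAt 0 x).hasDerivAt
  have h3 := ((P.hasDerivAt_tail x).add (h2.sub h1)).const_mul P.lam
  have he : P.lam * (-P.density x + (w x - ∫ s in (0 : ℝ)..x, w s * P.density (x - s)))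
      = P.lam * (w x - P.density x - ∫ s in (0 : ℝ)..x, w s * P.density (x - s)) := by ring
  rw [he] at h3
  refine h3.congr_of_eventuallyEq (Eventually.of_forall fun y => ?_)
  have hc := P.continuous_tail
  simp only [MD, Pi.add_apply, Pi.sub_apply]
  rw [← intervalIntegral.integral_sub (hw.intervalIntegrable _ _)
    (Continuous.intervalIntegrable (by fun_prop) _ _)]
  congr 2
  exact intervalIntegral.integral_congr fun s _ => by ring

theorem continuous_MD {w : ℝ → ℝ} (hw : Continuous w) : Continuous (P.MD w) :=
  continuous_iff_continuousAt.2 fun x => (P.hasDerivAt_MD hw x).continuousAt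

theorem MD_congr {u v : ℝ → ℝ} {x : ℝ} (hx : 0 ≤ x) (h : ∀ s ∈ Icc 0 x, u s = v s) :
    P.MD u x = P.MD v x := by
  unfold MD
  congr 2
  exact intervalIntegral.integral_congr fun s hs => by
    rw [uIcc_of_le hx] at hs
    simp only [h s hs]

/-- The kernel `tail` takes values in `[0,1]`. The bound is kept as an integral because integrating
an exponential weight is what produces contractions later. -/
theorem abs_MD_sub_le {u v g : ℝ → ℝ} (hu : Continuous u) (hv : Continuous v) (hg : Continuous g)
    {x : ℝ} (hx : 0 ≤ x) (h : ∀ s ∈ Icc 0 x, |u s - v s| ≤ g s) :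
    |P.MD u x - P.MD v x| ≤ P.lam * ∫ s in (0 : ℝ)..x, g s := by
  have hc := P.continuous_tail
  have e : P.MD u x - P.MD v x = P.lam * ∫ s in (0 : ℝ)..x, (u s - v s) * P.tail (x - s) := by
    unfold MD
    rw [← mul_sub, add_sub_add_left_eq_sub, ← intervalIntegral.integral_sub
      (Continuous.intervalIntegrable (by fun_prop) _ _)
      (Continuous.intervalIntegrable (by fun_prop) _ _)]
    congr 1
    exact intervalIntegral.integral_congr fun s _ => by ring
  rw [e, abs_mul, abs_of_pos P.lam_pos]
  refine mul_le_mul_of_nonneg_left ?_ P.lam_pos.le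
  rw [← Real.norm_eq_abs]
  refine intervalIntegral.norm_integral_le_of_norm_le hx
    (Eventually.of_forall fun s hs => ?_) (hg.intervalIntegrable _ _)
  rw [Real.norm_eq_abs, abs_mul, abs_of_nonneg (P.tail_nonneg (sub_nonneg.2 hs.2))]
  have h1 := h s ⟨hs.1.le, hs.2⟩
  have h2 := P.tail_le_one (sub_nonneg.2 hs.2)
  have h3 := P.tail_nonneg (sub_nonneg.2 hs.2)
  nlinarith [abs_nonneg (u s - v s)]

theorem MD_zero_le {x : ℝ} (hx : 0 ≤ x) : |P.MD 0 x| ≤ P.lam := by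
  have h1 := P.tail_le_one hx
  have h2 := P.tail_nonneg hx
  have h3 := P.lam_pos
  simp only [MD, Pi.zero_apply, zero_mul, intervalIntegral.integral_zero, add_zero]
  rw [abs_of_nonneg (by positivity)]
  nlinarith

theorem abs_MD_le {u g : ℝ → ℝ} (hu : Continuous u) (hg : Continuous g)
    {x : ℝ} (hx : 0 ≤ x) (h : ∀ s ∈ Icc 0 x, |u s| ≤ g s) :
    |P.MD u x| ≤ P.lam * (1 + ∫ s in (0 : ℝ)..x, g s) := by
  have h1 := P.abs_MD_sub_le hu (v := 0) continuous_zero hg hx (by simpa using h)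
  have h2 := P.MD_zero_le hx
  have h3 := abs_sub_abs_le_abs_sub (P.MD u x) (P.MD 0 x)
  linarith

theorem eq_one_add_integral {V w : ℝ → ℝ} (hw : Continuous w)
    (hV : ∀ y, 0 < y → HasDerivAt V (w y) y) (h0 : Tendsto V (𝓝[>] 0) (𝓝 1)) {y : ℝ}
    (hy : 0 < y) : V y = 1 + ∫ s in (0 : ℝ)..y, w s := by
  set U : ℝ → ℝ := fun y => 1 + ∫ s in (0 : ℝ)..y, w s with hU
  have hUd : ∀ y, HasDerivAt U (w y) y := fun y =>
    (hw.integral_hasStrictDerivAt 0 y).hasDerivAt.const_add 1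
  have hU0 : Tendsto U (𝓝[>] 0) (𝓝 1) := by
    have := (hUd 0).continuousAt.tendsto.mono_left (nhdsWithin_le_nhds (s := Ioi 0))
    simpa [hU] using this
  have hconst : ∀ z ∈ Ioi (0 : ℝ), V z - U z = V y - U y := fun z hz =>
    (convex_Ioi (0 : ℝ)).is_const_of_fderivWithin_eq_zero (𝕜 := ℝ) (f := fun z => V z - U z)
      (fun z hz => ((hV z hz).sub (hUd z)).differentiableAt.differentiableWithinAt)
      (fun z hz => by
        have h := ((hV z hz).sub (hUd z)).hasFDerivAt
        rw [sub_self] at h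
        have h2 := h.hasFDerivWithinAt (s := Ioi 0)
          |>.fderivWithin (isOpen_Ioi.uniqueDiffWithinAt hz)
        rw [show (fun z => V z - U z) = V - U from rfl, h2]
        ext; simp) hz hy
  have hlim := (h0.sub hU0).congr' (f₂ := fun _ => V y - U y)
    (eventually_nhdsWithin_of_forall hconst)
  have := tendsto_nhds_unique hlim tendsto_const_nhds
  linarith

/-- Integration by parts with `1 - tail` as primitive of the density; the boundary value `U 0 = 1`
leaves the free term `tail x`. -/
theorem M_eq_MD {V w : ℝ → ℝ} (hw : Continuous w) {x : ℝ} (hx : 0 < x)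
    (hV : ∀ y ∈ Ioc 0 x, V y = 1 + ∫ s in (0 : ℝ)..y, w s) : P.M V x = P.MD w x := by
  set U : ℝ → ℝ := fun y => 1 + ∫ s in (0 : ℝ)..y, w s with hU
  have hUd : ∀ y, HasDerivAt U (w y) y := fun y =>
    (hw.integral_hasStrictDerivAt 0 y).hasDerivAt.const_add 1
  have hUc : Continuous U := continuous_iff_continuousAt.2 fun x => (hUd x).continuousAt
  have hVU : ∀ y ∈ Ioc 0 x, V y = U y := hV
  have hparts := intervalIntegral.integral_mul_deriv_eq_deriv_mul
    (u := fun s => U (x - s)) (u' := fun s => -w (x - s)) (v := fun s => 1 - P.tail s)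
    (v' := P.density) (a := 0) (b := x)
    (fun s _ => by
      simpa using (hUd (x - s)).comp_const_sub x s)
    (fun s _ => by simpa using (P.hasDerivAt_tail s).const_sub 1)
    (Continuous.intervalIntegrable (by fun_prop) _ _)
    (P.continuous_density.intervalIntegrable _ _)
  have hc := P.continuous_tail
  have e1 : ∫ s in (0 : ℝ)..x, V (x - s) * P.f s = ∫ s in (0 : ℝ)..x, U (x - s) * P.density s := by
    -- The endpoint `s = x` is dropped because it involves `V 0`, about which nothing is known.
    rw [intervalIntegral.integral_of_le hx.le, intervalIntegral.integral_of_le hx.le,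
      integral_Ioc_eq_integral_Ioo, integral_Ioc_eq_integral_Ioo]
    refine setIntegral_congr_fun measurableSet_Ioo fun s hs => ?_
    simp only [hVU (x - s) ⟨sub_pos.2 hs.2, by linarith [hs.1]⟩, P.density_of_nonneg hs.1.le]
  have e2 : ∫ s in (0 : ℝ)..x, w (x - s) * (1 - P.tail s)
      = ∫ s in (0 : ℝ)..x, w s * (1 - P.tail (x - s)) := by
    have := intervalIntegral.integral_comp_sub_left (a := 0) (b := x)
      (fun s => w s * (1 - P.tail (x - s))) x
    simpa using this
  have e3 : ∫ s in (0 : ℝ)..x, w s * (1 - P.tail (x - s))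
      = (∫ s in (0 : ℝ)..x, w s) - ∫ s in (0 : ℝ)..x, w s * P.tail (x - s) := by
    rw [← intervalIntegral.integral_sub (hw.intervalIntegrable _ _)
      (Continuous.intervalIntegrable (by fun_prop) _ _)]
    exact intervalIntegral.integral_congr fun s _ => by ring
  unfold M MD
  rw [e1, hparts, hVU x ⟨hx, le_rfl⟩]
  simp only [neg_mul, intervalIntegral.integral_neg, e2, e3, tail_zero, sub_self, mul_zero,
    sub_zero, hU, intervalIntegral.integral_same]
  ring

end Model

end

/-! ### The pointwise maximization and its truncated form. -/

namespace Model

variable (P : Model)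

/-- The infimum in the operator `T`, in terms of `D = M(W)(x) - (c + r x) W'(x)` and
`E = (μ - r) x W'(x)`, without the factor `2 / (σ² x²)`. -/
noncomputable def J (A D E : ℝ) : ℝ :=
  sInf ((fun θ => D / θ ^ 2 - E / θ) '' {θ | θ ∈ Icc (-P.b) P.a ∧ A < |θ|})

/-- `sup_{θ ∈ [-b,a]} (z θ² + E θ - D) = 0`, with the supremum attained. -/
def IsHJBValue (D E z : ℝ) : Prop :=
  (∀ θ ∈ Icc (-P.b) P.a, z * θ ^ 2 + E * θ - D ≤ 0) ∧
    ∃ θ ∈ Icc (-P.b) P.a, z * θ ^ 2 + E * θ - D = 0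

variable {P} {A D E : ℝ}

theorem abs_div_sq_sub_div_le {θ : ℝ} (hA : 0 < A) (h : A ≤ |θ|) :
    |D / θ ^ 2 - E / θ| ≤ |D| / A ^ 2 + |E| / A := by
  refine (abs_sub _ _).trans (add_le_add ?_ ?_)
  · rw [abs_div, abs_pow]; gcongr
  · rw [abs_div]; gcongr

theorem J_bddBelow (hA : 0 < A) :
    BddBelow ((fun θ => D / θ ^ 2 - E / θ) '' {θ | θ ∈ Icc (-P.b) P.a ∧ A < |θ|}) := by
  refine ⟨-(|D| / A ^ 2 + |E| / A), ?_⟩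
  rintro _ ⟨θ, hθ, rfl⟩
  exact (abs_le.1 (abs_div_sq_sub_div_le hA hθ.2.le)).1

theorem J_nonempty (D E : ℝ) (hA : A < P.a) :
    ((fun θ => D / θ ^ 2 - E / θ) '' {θ | θ ∈ Icc (-P.b) P.a ∧ A < |θ|}).Nonempty :=
  ⟨_, P.a, ⟨⟨by linarith [P.a_pos, P.b_pos], le_rfl⟩, by rwa [abs_of_pos P.a_pos]⟩, rfl⟩

/-- The constraint set excludes `|θ| = A`, but such a `θ` is the limit of the points `t θ`, `t ↓ 1`,
which stay in `[-b,a]` because `A < min(a,b)`. -/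
theorem J_le (hA : 0 < A) (hA' : A < min P.a P.b) {θ : ℝ} (hθ : θ ∈ Icc (-P.b) P.a)
    (h : A ≤ |θ|) : P.J A D E ≤ D / θ ^ 2 - E / θ := by
  rcases h.lt_or_eq with h | h
  · exact csInf_le (J_bddBelow hA) ⟨θ, ⟨hθ, h⟩, rfl⟩
  have hθ0 : θ ≠ 0 := by rintro rfl; simp at h; linarith
  have hc : ContinuousAt (fun t : ℝ => D / (t * θ) ^ 2 - E / (t * θ)) 1 := by
    have h1 : (1 * θ) ^ 2 ≠ 0 := by simpa using hθ0
    have h2 : 1 * θ ≠ 0 := by simpa using hθ0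
    fun_prop (disch := assumption)
  have hlim : Tendsto (fun t : ℝ => D / (t * θ) ^ 2 - E / (t * θ)) (𝓝[>] 1)
      (𝓝 (D / θ ^ 2 - E / θ)) := by
    simpa using hc.tendsto.mono_left nhdsWithin_le_nhds
  refine ge_of_tendsto hlim ?_
  have hlt : 1 < min P.a P.b / A := (one_lt_div hA).2 hA'
  filter_upwards [Ioo_mem_nhdsGT hlt] with t ht
  have ht' : t * A < min P.a P.b := (lt_div_iff₀ hA).1 ht.2
  have hm := lt_min_iff.1 ht'
  have habs : |t * θ| = t * A := by rw [abs_mul, ← h, abs_of_pos (by linarith [ht.1])]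
  have hle := abs_le.1 habs.le
  exact csInf_le (J_bddBelow hA) ⟨t * θ, ⟨⟨by linarith [hm.2], by linarith [hm.1]⟩, by
    rw [habs]; nlinarith [ht.1]⟩, rfl⟩

theorem le_J (hA' : A < P.a) {z : ℝ}
    (h : ∀ θ ∈ Icc (-P.b) P.a, A < |θ| → z ≤ D / θ ^ 2 - E / θ) : z ≤ P.J A D E := by
  refine le_csInf (J_nonempty D E hA') ?_
  rintro _ ⟨θ, hθ, rfl⟩
  exact h θ hθ.1 hθ.2

/-- For `|θ| > A` each competitor is Lipschitz in `(D,E)` with constants independent of `θ`, and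
infima preserve this. This is what the cut-off buys. -/
theorem J_sub_le (hA : 0 < A) (hA' : A < P.a) (D E D' E' : ℝ) :
    P.J A D E - P.J A D' E' ≤ |D - D'| / A ^ 2 + |E - E'| / A := by
  rw [sub_le_comm]
  refine le_J hA' fun θ hθ h => ?_
  have h1 : P.J A D E ≤ D / θ ^ 2 - E / θ := csInf_le (J_bddBelow hA) ⟨θ, ⟨hθ, h⟩, rfl⟩
  have h2 := (abs_le.1 (abs_div_sq_sub_div_le (D := D - D') (E := E - E') hA h.le)).2
  rw [sub_div, sub_div] at h2
  linarith

theorem abs_J_sub_le (hA : 0 < A) (hA' : A < P.a) (D E D' E' : ℝ) :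
    |P.J A D E - P.J A D' E'| ≤ |D - D'| / A ^ 2 + |E - E'| / A := by
  rw [abs_le]
  have h1 := J_sub_le hA hA' D E D' E'
  have h2 := J_sub_le hA hA' D' E' D E
  rw [abs_sub_comm D', abs_sub_comm E'] at h2
  exact ⟨by linarith, h1⟩

theorem continuous_J (hA : 0 < A) (hA' : A < P.a) : Continuous fun p : ℝ × ℝ => P.J A p.1 p.2 := by
  rw [continuous_iff_continuousAt]
  intro p
  have h : Tendsto (fun q : ℝ × ℝ => |q.1 - p.1| / A ^ 2 + |q.2 - p.2| / A) (𝓝 p) (𝓝 0) := by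
    have : Continuous fun q : ℝ × ℝ => |q.1 - p.1| / A ^ 2 + |q.2 - p.2| / A := by fun_prop
    simpa using this.tendsto p
  refine tendsto_iff_dist_tendsto_zero.2 (squeeze_zero (fun _ => dist_nonneg) (fun q => ?_) h)
  exact abs_J_sub_le hA hA' _ _ _ _

/-- Dividing the quadratic by `θ²` shows `D/θ² - E/θ` to be `z` plus a nonnegative term that
vanishes at the root `θ₀`, which survives the cut-off. -/
theorem J_eq (hA : 0 < A) (hA' : A < min P.a P.b) {z θ₀ : ℝ}
    (hle : ∀ θ ∈ Icc (-P.b) P.a, z * θ ^ 2 + E * θ - D ≤ 0) (hθ₀ : θ₀ ∈ Icc (-P.b) P.a)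
    (h0 : A ≤ |θ₀|) (heq : z * θ₀ ^ 2 + E * θ₀ - D = 0) : P.J A D E = z := by
  have key : ∀ θ : ℝ, A ≤ |θ| → D / θ ^ 2 - E / θ = z - (z * θ ^ 2 + E * θ - D) / θ ^ 2 := by
    intro θ h
    have : θ ≠ 0 := by rintro rfl; simp at h; linarith
    field_simp
    ring
  refine le_antisymm ?_ (le_J (lt_min_iff.1 hA').1 fun θ hθ h => ?_)
  · have := J_le (D := D) (E := E) hA hA' hθ₀ h0
    rwa [key θ₀ h0, heq, zero_div, sub_zero] at this
  · rw [key θ h.le]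
    have := div_nonpos_of_nonpos_of_nonneg (hle θ hθ) (sq_nonneg θ)
    linarith

theorem exists_J_eq (hA : 0 < A) (hA' : A < min P.a P.b) (D E : ℝ) :
    ∃ θ ∈ Icc (-P.b) P.a, A ≤ |θ| ∧ P.J A D E = D / θ ^ 2 - E / θ := by
  have hm := lt_min_iff.1 hA'
  have hcomp : IsCompact (Icc (-P.b) P.a ∩ {θ | A ≤ |θ|}) :=
    isCompact_Icc.inter_right (isClosed_le continuous_const continuous_abs)
  have hcont : ContinuousOn (fun θ => D / θ ^ 2 - E / θ) (Icc (-P.b) P.a ∩ {θ | A ≤ |θ|}) := by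
    intro θ hθ
    have : θ ≠ 0 := by rintro rfl; have := hθ.2; simp at this; linarith
    have h2 : θ ^ 2 ≠ 0 := pow_ne_zero 2 this
    exact ContinuousAt.continuousWithinAt (by fun_prop (disch := assumption))
  obtain ⟨θ, hθ, hmin⟩ := hcomp.exists_isMinOn
    ⟨P.a, ⟨by linarith [P.a_pos, P.b_pos], le_rfl⟩, by
      simpa [abs_of_pos P.a_pos] using hm.1.le⟩ hcont
  exact ⟨θ, hθ.1, hθ.2, le_antisymm (J_le hA hA' hθ.1 hθ.2)
    (le_J hm.1 fun τ hτ h => hmin ⟨hτ, h.le⟩)⟩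

/-- No discarded competitor beats those kept: a negative one loses to `-A`, and a positive one loses
to `A` because `D/θ² - E/θ` decreases on `(0, 2D/E]`, which contains `A`. -/
theorem isHJBValue_J (hA : 0 < A) (hA' : A < min P.a P.b) (hD : 0 < D) (hE : 0 < E)
    (h : A * E ≤ 2 * D) : P.IsHJBValue D E (P.J A D E) := by
  have hm := lt_min_iff.1 hA'
  have key : ∀ θ : ℝ, θ ≠ 0 → (D / θ ^ 2 - E / θ) * θ ^ 2 + E * θ - D = 0 := by
    intro θ h; field_simp; ring
  refine ⟨fun θ hθ => ?_, ?_⟩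
  · rcases eq_or_ne θ 0 with rfl | h0
    · simpa using hD.le
    have hle : P.J A D E ≤ D / θ ^ 2 - E / θ := by
      rcases le_or_gt A |θ| with h1 | h1
      · exact J_le hA hA' hθ h1
      rw [abs_lt] at h1
      rcases lt_or_gt_of_ne h0 with h2 | h2
      · refine (J_le (θ := -A) hA hA' ⟨by linarith, by linarith [P.a_pos]⟩ (by simp [abs_of_pos hA])).trans ?_
        have e1 : D / (-A) ^ 2 ≤ D / θ ^ 2 := by
          apply div_le_div_of_nonneg_left hD.le (by positivity); nlinarith
        have e2 : E / (-θ) ≥ E / A := by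
          apply div_le_div_of_nonneg_left hE.le (by linarith); linarith
        rw [div_neg] at e2 ⊢
        linarith
      · refine (J_le (θ := A) hA hA' ⟨by linarith [P.b_pos], by linarith⟩ (by simp [abs_of_pos hA])).trans ?_
        have e : D / θ ^ 2 - E / θ - (D / A ^ 2 - E / A)
            = (A - θ) * (D * (A + θ) - E * A * θ) / (θ ^ 2 * A ^ 2) := by
          field_simp; ring
        have : 0 ≤ (A - θ) * (D * (A + θ) - E * A * θ) / (θ ^ 2 * A ^ 2) := by
          apply div_nonneg (mul_nonneg (by linarith) _) (by positivity)
          nlinarith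
        linarith
    have := mul_le_mul_of_nonneg_right hle (sq_nonneg θ)
    linarith [key θ h0]
  · obtain ⟨θ, hθ, h1, h2⟩ := exists_J_eq hA hA' D E
    have : θ ≠ 0 := by rintro rfl; simp at h1; linarith
    exact ⟨θ, hθ, by rw [h2, key θ this]⟩

/-- At a root of one quadratic, nonzero because `D > 0`, the other quadratic is nonpositive; this
orders the leading coefficients, and the roles can be exchanged. -/
theorem IsHJBValue.unique {z z' : ℝ} (hD : 0 < D) (h : P.IsHJBValue D E z)
    (h' : P.IsHJBValue D E z') : z = z' := by
  have aux : ∀ {z z' : ℝ}, P.IsHJBValue D E z → P.IsHJBValue D E z' → z' ≤ z := by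
    intro z z' h h'
    obtain ⟨θ, hθ, e⟩ := h.2
    have h1 := h'.1 θ hθ
    have : θ ≠ 0 := by rintro rfl; simp at e; linarith
    have : 0 < θ ^ 2 := by positivity
    nlinarith
  exact le_antisymm (aux h' h) (aux h h')

/-- Complete the square: the bound is the unconstrained minimum, taken at `θ = 2D/E`. It limits how
fast `w` can decrease while `D` is large. -/
theorem neg_sq_div_le_J (hA : 0 < A) (hA' : A < P.a) (hD : 0 < D) :
    -(E ^ 2 / (4 * D)) ≤ P.J A D E := by
  refine le_J hA' fun θ hθ h => ?_
  have h0 : θ ≠ 0 := by rintro rfl; simp at h; linarith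
  have e : D / θ ^ 2 - E / θ + E ^ 2 / (4 * D) = (2 * D - E * θ) ^ 2 / (4 * D * θ ^ 2) := by
    field_simp; ring
  have : 0 ≤ (2 * D - E * θ) ^ 2 / (4 * D * θ ^ 2) := by positivity
  linarith

/-- Test with `θ = t`. When `D` is small compared with `E`, a small `t` is allowed and `w'` becomes
very negative, which pushes `D` up. -/
theorem J_le_neg_div (hA : 0 < A) (hA' : A < min P.a P.b) {t : ℝ} (ht : A ≤ t) (ht' : t ≤ P.a)
    (h : 2 * D ≤ E * t) : P.J A D E ≤ -(E / (2 * t)) := by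
  have ht0 : 0 < t := by linarith
  refine (J_le hA hA' ⟨by linarith [P.b_pos], ht'⟩ (by rwa [abs_of_pos ht0])).trans ?_
  have e : -(E / (2 * t)) - (D / t ^ 2 - E / t) = (E * t - 2 * D) / (2 * t ^ 2) := by
    field_simp; ring
  have : 0 ≤ (E * t - 2 * D) / (2 * t ^ 2) := div_nonneg (by linarith) (by positivity)
  linarith

/-- An interior maximum. -/
theorem IsHJBValue.eq_of_lt {z : ℝ} (h : P.IsHJBValue D E z) (hD : 0 < D) (hE : 0 < E)
    (h1 : 2 * D < E * P.a) : z = -(E ^ 2 / (4 * D)) := by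
  have hle := h.1 (2 * D / E) ⟨by have := P.b_pos; have : 0 < 2 * D / E := by positivity
                                  linarith, by rw [div_le_iff₀ hE]; linarith⟩
  have e : z * (2 * D / E) ^ 2 + E * (2 * D / E) - D = (4 * D / E ^ 2) * (z * D) + D := by
    field_simp; ring
  have h2 : z * (4 * D) ≤ -E ^ 2 := by
    rw [e, div_mul_eq_mul_div, ← le_neg_iff_add_nonpos_right, div_le_iff₀ (by positivity)] at hle
    nlinarith
  -- A real root makes the discriminant `E² + 4 z D` nonnegative; testing the vertex gave the
  -- reverse inequality.
  obtain ⟨θ, hθ, he⟩ := h.2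
  have h3 : -E ^ 2 ≤ z * (4 * D) := by nlinarith [sq_nonneg (2 * z * θ + E), h2, sq_nonneg E]
  have : z * (4 * D) = -E ^ 2 := le_antisymm h2 h3
  field_simp
  linarith

/-- A maximum at the endpoint `a`. -/
theorem IsHJBValue.eq_at_a {z : ℝ} (h : P.IsHJBValue D E z) (hD : 0 < D) (hE : 0 < E)
    (h1 : E * P.a ≤ 2 * D) (h2 : D * (P.b - P.a) ≤ E * P.a * P.b) :
    z * P.a ^ 2 + E * P.a - D = 0 := by
  have ha := P.a_pos
  have hb := P.b_pos
  have hla := h.1 P.a ⟨by linarith, le_rfl⟩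
  obtain ⟨θ, hθ, he⟩ := h.2
  by_contra hne
  have hlt : z * P.a ^ 2 + E * P.a - D < 0 := lt_of_le_of_ne hla hne
  have h0 : θ ≠ 0 := by rintro rfl; simp at he; linarith
  have hθ2 : 0 < θ ^ 2 := by positivity
  -- The root `θ` would be a strictly better competitor than `a`. For negative `θ` this is refuted
  -- through `-b`, for positive `θ` by monotonicity on `(0,a]`.
  have key : (D - E * θ) * P.a ^ 2 < (D - E * P.a) * θ ^ 2 := by
    have : z * θ ^ 2 = D - E * θ := by linarith
    rw [← this]
    nlinarith
  rcases lt_or_gt_of_ne h0 with hn | hp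
  · have k1 : (D - E * P.a) * P.b ^ 2 ≤ (D + E * P.b) * P.a ^ 2 := by
      nlinarith [mul_le_mul_of_nonneg_right h2 (by linarith : 0 ≤ P.a + P.b)]
    have k2 : (D + E * P.b) * θ ^ 2 ≤ (D - E * θ) * P.b ^ 2 := by
      have hb' : 0 ≤ P.b + θ := by linarith [hθ.1]
      have : 0 ≤ D * ((P.b + θ) * (P.b - θ)) + E * (-θ) * P.b * (P.b + θ) := by
        have : 0 < P.b - θ := by linarith
        have : 0 < -θ := by linarith
        positivity
      nlinarith
    have k3 := mul_lt_mul_of_pos_right key (by positivity : 0 < P.b ^ 2)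
    have k4 := mul_le_mul_of_nonneg_right k1 hθ2.le
    have k5 := mul_le_mul_of_nonneg_right k2 (by positivity : 0 ≤ P.a ^ 2)
    nlinarith
  · have ht : θ ≤ P.a := hθ.2
    have : 0 ≤ (P.a - θ) * (D * (P.a + θ) - E * θ * P.a) := by
      apply mul_nonneg (by linarith)
      nlinarith [mul_le_mul_of_nonneg_left ht (by positivity : 0 ≤ E * P.a)]
    nlinarith

/-- A maximum at the endpoint `-b`. -/
theorem IsHJBValue.eq_at_neg_b {z : ℝ} (h : P.IsHJBValue D E z) (hab : P.a < P.b) (hD : 0 < D)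
    (hE : 0 < E) (h2 : E * P.a * P.b < D * (P.b - P.a)) :
    z * P.b ^ 2 - E * P.b - D = 0 := by
  have ha := P.a_pos
  have hb := P.b_pos
  have hla := h.1 P.a ⟨by linarith, le_rfl⟩
  have hlb := h.1 (-P.b) ⟨le_rfl, by linarith⟩
  obtain ⟨θ, hθ, he⟩ := h.2
  by_contra hne
  have hlt : z * P.b ^ 2 - E * P.b - D < 0 := lt_of_le_of_ne (by linarith) hne
  have h0 : θ ≠ 0 := by rintro rfl; simp at he; linarith
  have hθ2 : 0 < θ ^ 2 := by positivity
  have key : (D - E * θ) * P.b ^ 2 < (D + E * P.b) * θ ^ 2 := by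
    have : z * θ ^ 2 = D - E * θ := by linarith
    rw [← this]
    nlinarith
  rcases lt_or_gt_of_ne h0 with hn | hp
  · have hb' : 0 ≤ P.b + θ := by linarith [hθ.1]
    have : 0 ≤ D * ((P.b + θ) * (P.b - θ)) + E * (-θ) * P.b * (P.b + θ) := by
      have : 0 < P.b - θ := by linarith
      have : 0 < -θ := by linarith
      positivity
    nlinarith
  -- On the positive side `a` does at least as well as `θ` (`k0`), and `-b` at least as well as `a`
  -- (`k1`).
  · have ht : θ ≤ P.a := hθ.2
    have hDa : E * P.a ≤ D := by
      by_contra hcon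
      push Not at hcon
      nlinarith [mul_lt_mul_of_pos_right hcon (by linarith : 0 < P.b - P.a),
        mul_pos hE (mul_pos ha ha)]
    have k0 : (D - E * P.a) * θ ^ 2 ≤ (D - E * θ) * P.a ^ 2 := by
      have : 0 ≤ (P.a - θ) * (D * (P.a + θ) - E * θ * P.a) := by
        apply mul_nonneg (by linarith)
        nlinarith [mul_le_mul_of_nonneg_left ht (by positivity : 0 ≤ E * P.a)]
      nlinarith
    have k1 : (D + E * P.b) * P.a ^ 2 ≤ (D - E * P.a) * P.b ^ 2 := by
      nlinarith [mul_le_mul_of_nonneg_right h2.le (by linarith : 0 ≤ P.a + P.b)]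
    have k3 := mul_lt_mul_of_pos_right key (by positivity : 0 < P.a ^ 2)
    have k4 := mul_le_mul_of_nonneg_right k1 hθ2.le
    have k5 := mul_le_mul_of_nonneg_right k0 (by positivity : 0 ≤ P.b ^ 2)
    nlinarith

theorem T_eq_J (hA : 0 < A) (G : ℝ → ℝ) (ε : ℝ) (w : ℝ → ℝ) (x : ℝ) :
    P.T A G ε w x = 2 / (P.σ ^ 2 * x ^ 2) *
      P.J A (P.M (extend G ε w) x - (P.c + P.r * x) * w x) ((P.μ - P.r) * x * w x) := by
  have hpos : 0 ≤ (P.σ ^ 2 * x ^ 2)⁻¹ := by positivity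
  rw [T, J, div_eq_mul_inv, mul_assoc, ← smul_eq_mul (P.σ ^ 2 * x ^ 2)⁻¹,
    ← Real.sInf_smul_of_nonneg hpos]
  congr 2
  rw [← image_smul, image_image]
  refine image_congr fun θ hθ => ?_
  have : θ ≠ 0 := by rintro rfl; have := hθ.2; simp at this; linarith
  simp only [smul_eq_mul]
  -- Nothing is assumed about `x`: if `σ² x² = 0`, both sides vanish by the convention for division
  -- by zero.
  rcases eq_or_ne (P.σ ^ 2 * x ^ 2) 0 with h0 | h0
  · rw [mul_assoc (θ ^ 2), h0]; simp
  · rw [mul_assoc (θ ^ 2)]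
    generalize P.σ ^ 2 * x ^ 2 = q at h0
    field_simp
    ring

/-! ### Reading off the maximizer from `φ`. -/

variable {P : Model} {W : ℝ → ℝ} {x : ℝ}

theorem L_eq (θ : ℝ) : P.L θ W x = P.σ ^ 2 * x ^ 2 * deriv (deriv W) x / 2 * θ ^ 2
    + (P.μ - P.r) * x * deriv W x * θ - (P.M W x - (P.c + P.r * x) * deriv W x) := by
  unfold L; ring

theorem IsHJBValue.solvesHJBWith {γ : ℝ}
    (h : P.IsHJBValue (P.M W x - (P.c + P.r * x) * deriv W x) ((P.μ - P.r) * x * deriv W x)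
      (P.σ ^ 2 * x ^ 2 * deriv (deriv W) x / 2)) (hγ : γ ∈ Icc (-P.b) P.a)
    (he : P.σ ^ 2 * x ^ 2 * deriv (deriv W) x / 2 * γ ^ 2
      + (P.μ - P.r) * x * deriv W x * γ - (P.M W x - (P.c + P.r * x) * deriv W x) = 0) :
    P.SolvesHJBWith γ W x := by
  refine ⟨hγ, fun θ hθ => ?_, by rw [L_eq, he]⟩
  simp only [mem_ofPred_eq, L_eq, he]
  exact h.1 θ hθ

/-- The maximizer of the HJB equation at a point, by cases on `φ_W(x)`. -/
theorem IsHJBValue.maximizer (hμr : P.r < P.μ) (hab : P.a < P.b) (hx : 0 < x)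
    (hw : 0 < deriv W x) (hD : 0 < P.M W x - (P.c + P.r * x) * deriv W x)
    (h : P.IsHJBValue (P.M W x - (P.c + P.r * x) * deriv W x) ((P.μ - P.r) * x * deriv W x)
      (P.σ ^ 2 * x ^ 2 * deriv (deriv W) x / 2)) :
    (P.phi W x < P.a → deriv (deriv W) x ≠ 0 ∧ P.SolvesHJBWith (P.alpha W x) W x ∧
      P.alphaStar W x = P.alpha W x ∧ P.alpha W x = P.phi W x) ∧
    (P.a ≤ P.phi W x → P.phi W x ≤ 2 * P.a * P.b / (P.b - P.a) →
      P.SolvesHJBWith P.a W x ∧ P.alphaStar W x = P.a) ∧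
    (2 * P.a * P.b / (P.b - P.a) < P.phi W x →
      P.SolvesHJBWith (-P.b) W x ∧ P.alphaStar W x = -P.b) ∧
    0 < P.phi W x := by
  have ha := P.a_pos
  have hb := P.b_pos
  have hs := P.σ_pos
  have hk : 0 < P.μ - P.r := sub_pos.2 hμr
  have hba : 0 < P.b - P.a := sub_pos.2 hab
  have hsolve := @IsHJBValue.solvesHJBWith P W x
  set D := P.M W x - (P.c + P.r * x) * deriv W x with hDdef
  set E := (P.μ - P.r) * x * deriv W x with hEdef
  set w₂ := deriv (deriv W) x with hw₂
  set p := P.σ ^ 2 * x ^ 2 * w₂ / 2 with hp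
  have hE : 0 < E := by positivity
  have hphi : P.phi W x = 2 * D / E := rfl
  have hq : 0 < P.σ ^ 2 * x ^ 2 := by positivity
  have hw₂p : w₂ = 2 * p / (P.σ ^ 2 * x ^ 2) := by rw [hp]; field_simp
  have halpha : P.alpha W x = -E / (2 * p) := by
    rw [alpha, ← hw₂, hp, hEdef]
    -- If `w₂ = 0`, both quotients are `0` by convention.
    rcases eq_or_ne w₂ 0 with h0 | h0
    · simp [h0]
    · field_simp
  have hneg : w₂ < 0 ↔ p < 0 := by
    rw [hw₂p, div_neg_iff]
    constructor
    · rintro (h | h) <;> linarith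
    · intro h; right; exact ⟨by linarith, hq⟩
  have hpos : 0 < w₂ ↔ 0 < p := by
    rw [hw₂p, div_pos_iff]
    constructor
    · rintro (h | h) <;> linarith
    · intro h; left; exact ⟨by linarith, hq⟩
  have hstar : P.alphaStar W x = if p < 0 then
        if P.a < P.alpha W x then P.a
        else if P.alpha W x < -P.b then -P.b else P.alpha W x
      else if 0 < p then if P.alpha W x ≤ (P.a - P.b) / 2 then P.a else -P.b
      else P.a := by
    unfold alphaStar
    simp only [← hw₂, hneg, hpos, if_pos hμr.le]
  have hphi0 : 0 < 2 * D / E := by positivity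
  rw [hphi, hstar, halpha]
  clear_value D E w₂ p
  refine ⟨fun h1 => ?_, fun h1 h2 => ?_, fun h1 => ?_, hphi0⟩
  · have hz := h.eq_of_lt hD hE (by rw [div_lt_iff₀ hE] at h1; linarith)
    have hpn : p < 0 := by rw [hz]; simp only [neg_lt_zero]; positivity
    have hal : -E / (2 * p) = 2 * D / E := by rw [hz]; field_simp; ring
    refine ⟨(hneg.2 hpn).ne, ?_, ?_, hal⟩
    · rw [hal]
      refine hsolve h ⟨by linarith, h1.le⟩ ?_
      rw [hz]; field_simp; ring
    · rw [if_pos hpn, hal, if_neg (by linarith), if_neg (by linarith)]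
  · rw [le_div_iff₀ hE] at h1
    rw [div_le_div_iff₀ hE hba] at h2
    have hz := h.eq_at_a hD hE (by linarith) (by linarith)
    -- This follows from `p a² = D - E a` and `E a ≤ 2 D`; when `p < 0` it puts the vertex at or
    -- beyond `a`.
    have hpa : -E ≤ 2 * (p * P.a) := by
      refine le_of_mul_le_mul_right ?_ ha
      linarith
    refine ⟨hsolve h ⟨by linarith, le_rfl⟩ hz, ?_⟩
    split_ifs with hpn h3 h4 hpp h5
    · rfl
    · rw [div_lt_iff_of_neg (by linarith)] at h4
      linarith [mul_neg_of_neg_of_pos hpn hb]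
    · have hle : P.a ≤ -E / (2 * p) := by
        rw [le_div_iff_of_neg (by linarith)]
        linarith
      exact le_antisymm (not_lt.1 h3) hle
    · rfl
    · exfalso
      apply h5
      rw [div_le_iff₀ (by linarith)]
      -- For an upward parabola the endpoint farther from the vertex wins; this inequality puts the
      -- vertex on the left of the midpoint `(a-b)/2` or at it.
      have : p * (P.b - P.a) ≤ E := by
        refine le_of_mul_le_mul_right ?_ (by positivity : 0 < P.a ^ 2)
        have e : p * P.a ^ 2 * (P.b - P.a) = (D - E * P.a) * (P.b - P.a) := by
          rw [show p * P.a ^ 2 = D - E * P.a by linarith]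
        linarith
      linarith
    · rfl
  · rw [div_lt_div_iff₀ hba hE] at h1
    have hz := h.eq_at_neg_b hab hD hE (by linarith)
    have hpp : 0 < p := by
      have : 0 < p * P.b ^ 2 := by linarith [mul_pos hE hb]
      exact pos_of_mul_pos_left this (by positivity)
    refine ⟨hsolve h ⟨le_rfl, by linarith⟩ (by linarith), ?_⟩
    rw [if_neg (by linarith), if_pos hpp, if_neg]
    rw [not_le, lt_div_iff₀ (by linarith)]
    have : E < p * (P.b - P.a) := by
      refine lt_of_mul_lt_mul_right ?_ (by positivity : 0 ≤ P.b ^ 2)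
      have e : p * P.b ^ 2 * (P.b - P.a) = (D + E * P.b) * (P.b - P.a) := by
        rw [show p * P.b ^ 2 = D + E * P.b by linarith]
      linarith
    linarith

end Model

/-! ### Fixed points in weighted supremum norms. -/

open BoundedContinuousFunction in
/-- A contraction principle on continuous functions with a weighted supremum norm. -/
theorem exists_fixedPoint_of_weighted_contraction {ρ : ℝ → ℝ} (hρ : Continuous ρ)
    (hρ0 : ∀ x, 0 < ρ x) (S : (ℝ → ℝ) → ℝ → ℝ) (hcont : ∀ u, Continuous u → Continuous (S u))
    (hlip : ∀ u v C, Continuous u → Continuous v → 0 ≤ C → (∀ y, |u y - v y| ≤ C * ρ y) →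
      ∀ x, |S u x - S v x| ≤ C / 2 * ρ x)
    (h0 : ∃ C, ∀ x, |S 0 x| ≤ C * ρ x) : ∃ u, Continuous u ∧ S u = u := by
  obtain ⟨C₀, hC₀⟩ := h0
  have hmul : ∀ g : ℝ →ᵇ ℝ, Continuous fun y => ρ y * g y := fun g => hρ.mul g.continuous
  have hdiff : ∀ (g h : ℝ →ᵇ ℝ) x,
      |S (fun y => ρ y * g y) x - S (fun y => ρ y * h y) x| ≤ ‖g - h‖ / 2 * ρ x := fun g h =>
    hlip _ _ _ (hmul g) (hmul h) (norm_nonneg _) fun y => by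
      rw [← mul_sub, abs_mul, abs_of_pos (hρ0 y), mul_comm]
      exact mul_le_mul_of_nonneg_right ((g - h).norm_coe_le_norm y) (hρ0 y).le
  have hbound : ∀ (g : ℝ →ᵇ ℝ) x, ‖S (fun y => ρ y * g y) x / ρ x‖ ≤ ‖g‖ / 2 + C₀ := by
    intro g x
    have h1 := hdiff g 0 x
    rw [sub_zero, show (fun y => ρ y * (0 : ℝ →ᵇ ℝ) y) = 0 by ext; simp] at h1
    have h2 := abs_sub_abs_le_abs_sub (S (fun y => ρ y * g y) x) (S 0 x)
    rw [Real.norm_eq_abs, abs_div, abs_of_pos (hρ0 x), div_le_iff₀ (hρ0 x)]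
    linarith [hC₀ x]
  -- Conjugation by `ρ` turns the weighted norm into the supremum norm on bounded continuous
  -- functions.
  let Φ : (ℝ →ᵇ ℝ) → (ℝ →ᵇ ℝ) := fun g =>
    ofNormedAddCommGroup (fun x => S (fun y => ρ y * g y) x / ρ x)
      ((hcont _ (hmul g)).div hρ fun x => (hρ0 x).ne') _ (hbound g)
  have hΦ : ContractingWith (1 / 2) Φ := by
    refine ⟨by norm_num, LipschitzWith.of_dist_le_mul fun g h => ?_⟩
    rw [dist_eq_norm, dist_eq_norm]
    refine (norm_le (by positivity)).2 fun x => ?_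
    change ‖S (fun y => ρ y * g y) x / ρ x - S (fun y => ρ y * h y) x / ρ x‖ ≤ _
    rw [← sub_div, Real.norm_eq_abs, abs_div, abs_of_pos (hρ0 x), div_le_iff₀ (hρ0 x)]
    refine (hdiff g h x).trans (le_of_eq ?_)
    push_cast
    ring
  obtain ⟨g, hg, -⟩ := hΦ.exists_fixedPoint 0 (edist_ne_top _ _)
  refine ⟨fun y => ρ y * g y, hmul g, funext fun x => ?_⟩
  have : S (fun y => ρ y * g y) x / ρ x = g x := congrArg (fun f : ℝ →ᵇ ℝ => f x) hg
  rw [← this, mul_div_cancel₀ _ (hρ0 x).ne']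

theorem hasDerivAt_const_mul_exp (C K s : ℝ) :
    HasDerivAt (fun s => C * Real.exp (K * s)) (C * K * Real.exp (K * s)) s := by
  refine ((((hasDerivAt_id' s).const_mul K).exp).const_mul C).congr_deriv ?_
  ring

/-- Integration gains a factor `1/K`, so a large rate `K` makes Volterra operators contract. -/
theorem integral_const_mul_exp_le {C K : ℝ} (hC : 0 ≤ C) (hK : 0 < K) (a x : ℝ) :
    ∫ s in a..x, C * Real.exp (K * s) ≤ C / K * Real.exp (K * x) := by
  have h : ∀ s, HasDerivAt (fun s => C / K * Real.exp (K * s)) (C * Real.exp (K * s)) s := by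
    intro s
    refine (hasDerivAt_const_mul_exp (C / K) K s).congr_deriv ?_
    field_simp
  rw [intervalIntegral.integral_eq_sub_of_hasDerivAt (fun s _ => h s)
    (Continuous.intervalIntegrable (by fun_prop) _ _)]
  have : 0 ≤ C / K * Real.exp (K * a) := by positivity
  linarith

/-! ### Existence and uniqueness for the truncated equation. -/

namespace Model

variable (P : Model)

/-- The right hand side of the truncated equation for `w = W'`. -/
noncomputable def rhs (A : ℝ) (w : ℝ → ℝ) (x : ℝ) : ℝ :=
  2 / (P.σ ^ 2 * x ^ 2) *
    P.J A (P.MD w x - (P.c + P.r * x) * w x) ((P.μ - P.r) * x * w x)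

variable {P} {A ε : ℝ}

theorem continuousOn_rhs (hA : 0 < A) (hA' : A < P.a) {w : ℝ → ℝ} (hw : Continuous w) :
    ContinuousOn (P.rhs A w) (Ioi 0) := by
  have h1 := P.continuous_MD hw
  have h2 := (continuous_J hA hA').comp (f := fun x =>
    (P.MD w x - (P.c + P.r * x) * w x, (P.μ - P.r) * x * w x)) (by fun_prop)
  refine ContinuousOn.mul (fun x hx => ?_) h2.continuousOn
  have : P.σ ^ 2 * x ^ 2 ≠ 0 := by
    have := P.σ_pos
    have : 0 < x := hx
    positivity
  exact ContinuousAt.continuousWithinAt (by fun_prop (disch := assumption))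

/-- A Lipschitz constant for `rhs` on `[ε,∞)`. -/
noncomputable def rhsLip (P : Model) (A ε : ℝ) : ℝ :=
  2 / P.σ ^ 2 * ((1 / ε ^ 2 + P.c / ε ^ 2 + P.r / ε) / A ^ 2 + (P.μ - P.r) / (ε * A))

theorem rhsLip_pos (hμr : P.r < P.μ) (hA : 0 < A) (hε : 0 < ε) : 0 < P.rhsLip A ε := by
  have := P.σ_pos
  have := P.c_pos
  have := P.r_pos
  have : 0 < P.μ - P.r := sub_pos.2 hμr
  unfold rhsLip
  positivity

/-- The factor `2/(σ² x²)` absorbs the linear growth of the coefficients, so one constant serves all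
of `[ε,∞)`. -/
theorem abs_rhs_sub_le (hμr : P.r < P.μ) (hA : 0 < A) (hA' : A < P.a) (hε : 0 < ε)
    (u v : ℝ → ℝ) {x : ℝ} (hx : ε ≤ x) :
    |P.rhs A u x - P.rhs A v x| ≤ P.rhsLip A ε * (|u x - v x| + |P.MD u x - P.MD v x|) := by
  have hs := P.σ_pos
  have hc := P.c_pos
  have hr := P.r_pos
  have hk : 0 < P.μ - P.r := sub_pos.2 hμr
  have hx0 : 0 < x := by linarith
  have hcr : 0 < P.c + P.r * x := by positivity
  have hJ := abs_J_sub_le hA hA' (P.MD u x - (P.c + P.r * x) * u x) ((P.μ - P.r) * x * u x)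
    (P.MD v x - (P.c + P.r * x) * v x) ((P.μ - P.r) * x * v x)
  set m := |P.MD u x - P.MD v x| with hm
  set d := |u x - v x| with hd
  have hm0 : 0 ≤ m := abs_nonneg _
  have hd0 : 0 ≤ d := abs_nonneg _
  have h1 : |P.MD u x - (P.c + P.r * x) * u x - (P.MD v x - (P.c + P.r * x) * v x)|
      ≤ m + (P.c + P.r * x) * d := by
    rw [show P.MD u x - (P.c + P.r * x) * u x - (P.MD v x - (P.c + P.r * x) * v x)
      = (P.MD u x - P.MD v x) - (P.c + P.r * x) * (u x - v x) by ring]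
    refine (abs_sub _ _).trans (le_of_eq ?_)
    rw [abs_mul, abs_of_pos hcr]
  have h2 : |(P.μ - P.r) * x * u x - (P.μ - P.r) * x * v x| = (P.μ - P.r) * x * d := by
    rw [← mul_sub, abs_mul, abs_of_pos (by positivity : 0 < (P.μ - P.r) * x)]
  rw [h2] at hJ
  unfold rhs
  rw [← mul_sub, abs_mul, abs_of_pos (by positivity : 0 < 2 / (P.σ ^ 2 * x ^ 2))]
  calc _ ≤ 2 / (P.σ ^ 2 * x ^ 2) *
        ((m + (P.c + P.r * x) * d) / A ^ 2 + (P.μ - P.r) * x * d / A) := by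
        gcongr
        exact hJ.trans (by gcongr)
    _ = 2 / P.σ ^ 2 * ((1 / x ^ 2 * m + (P.c / x ^ 2 + P.r / x) * d) / A ^ 2
          + (P.μ - P.r) / (x * A) * d) := by field_simp
    _ ≤ 2 / P.σ ^ 2 * ((1 / ε ^ 2 * m + (P.c / ε ^ 2 + P.r / ε) * d) / A ^ 2
          + (P.μ - P.r) / (ε * A) * d) := by gcongr
    _ ≤ 2 / P.σ ^ 2 * (((1 / ε ^ 2 + P.c / ε ^ 2 + P.r / ε) * (d + m)) / A ^ 2
          + (P.μ - P.r) / (ε * A) * (d + m)) := by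
        have e1 : 0 ≤ (P.c / ε ^ 2 + P.r / ε) * m := by positivity
        have e2 : 0 ≤ 1 / ε ^ 2 * d := by positivity
        gcongr
        · linarith
        · linarith
    _ = P.rhsLip A ε * (d + m) := by unfold rhsLip; ring

/-- The increments of `rhs` under a weighted bound. -/
theorem abs_rhs_sub_le_of_weighted (hμr : P.r < P.μ) (hA : 0 < A) (hA' : A < P.a) (hε : 0 < ε)
    {u v : ℝ → ℝ} (hu : Continuous u) (hv : Continuous v) {C K x : ℝ} (hC : 0 ≤ C)
    (hK : P.lam ≤ K) (hx : ε ≤ x)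
    (h : ∀ y ∈ Icc 0 x, |u y - v y| ≤ C * Real.exp (K * y)) :
    |P.rhs A u x - P.rhs A v x| ≤ 2 * P.rhsLip A ε * C * Real.exp (K * x) := by
  have hx0 : 0 ≤ x := by linarith
  have hl := P.lam_pos
  have hK0 : 0 < K := by linarith
  have h1 := abs_rhs_sub_le hμr hA hA' hε u v hx
  have h2 := P.abs_MD_sub_le hu hv (g := fun y => C * Real.exp (K * y)) (by fun_prop) hx0 h
  have h3 := integral_const_mul_exp_le hC hK0 0 x
  have h4 : P.lam * (C / K * Real.exp (K * x)) ≤ C * Real.exp (K * x) := by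
    have : P.lam * (C / K * Real.exp (K * x)) = P.lam / K * (C * Real.exp (K * x)) := by ring
    rw [this]
    exact mul_le_of_le_one_left (by positivity) ((div_le_one hK0).2 hK)
  have h5 := h x ⟨hx0, le_rfl⟩
  have h6 := mul_le_mul_of_nonneg_left h3 hl.le
  have h7 := rhsLip_pos hμr hA hε
  refine h1.trans ?_
  rw [mul_comm 2, mul_assoc, mul_assoc]
  refine mul_le_mul_of_nonneg_left ?_ h7.le
  linarith

/-- Existence for the truncated equation. -/
theorem exists_solution (hμr : P.r < P.μ) (hA : 0 < A) (hA' : A < P.a) (hε : 0 < ε)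
    {w₀ : ℝ → ℝ} (hw₀ : Continuous w₀) (hb : ∃ B, ∀ x ≤ ε, |w₀ x| ≤ B) :
    ∃ w, Continuous w ∧ (∀ x ≤ ε, w x = w₀ x) ∧
      ∀ x, ε ≤ x → HasDerivWithinAt w (P.rhs A w x) (Ici ε) x := by
  obtain ⟨B, hB⟩ := hb
  have hR : ∀ u, Continuous u → Continuous fun y => P.rhs A u (max y ε) := fun u hu =>
    (continuousOn_rhs hA hA' hu).comp_continuous (by fun_prop)
      fun y => mem_Ioi.2 (lt_max_of_lt_right hε)
  have hL := rhsLip_pos hμr hA hε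
  have hl := P.lam_pos
  -- With this rate `2 rhsLip / K ≤ 1/2`, and `λ ≤ K` controls `MD` in the weighted norm.
  set K := P.lam + 4 * P.rhsLip A ε with hK
  have hK0 : 0 < K := by positivity
  set ρ : ℝ → ℝ := fun y => Real.exp (K * max y 0) with hρ
  have hρ1 : ∀ y, 1 ≤ ρ y := fun y => Real.one_le_exp (by positivity)
  -- The clamps keep the prescribed values on the left of `ε` and keep `rhs` away from its
  -- singularity at `0`.
  let S : (ℝ → ℝ) → ℝ → ℝ := fun u x =>
    w₀ (min x ε) + ∫ y in ε..max x ε, P.rhs A u (max y ε)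
  have hprim : ∀ u, Continuous u → ∀ x, HasDerivAt
      (fun x => w₀ ε + ∫ y in ε..x, P.rhs A u (max y ε)) (P.rhs A u (max x ε)) x := fun u hu x =>
    ((hR u hu).integral_hasStrictDerivAt ε x).hasDerivAt.const_add _
  have hlip : ∀ u v C, Continuous u → Continuous v → 0 ≤ C → (∀ y, |u y - v y| ≤ C * ρ y) →
      ∀ x, |S u x - S v x| ≤ C / 2 * ρ x := by
    intro u v C hu hv hC h x
    have hx : ε ≤ max x ε := le_max_right _ _
    simp only [S]
    rw [add_sub_add_left_eq_sub, ← intervalIntegral.integral_sub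
      ((hR u hu).intervalIntegrable _ _) ((hR v hv).intervalIntegrable _ _)]
    rcases le_or_gt x ε with hxε | hxε
    · rw [max_eq_right hxε]
      simp only [intervalIntegral.integral_same, abs_zero]
      have := hρ1 x
      positivity
    have hx0 : 0 < x := by linarith
    rw [max_eq_left hxε.le]
    have hb : ∀ y ∈ Ioc ε x, ‖P.rhs A u (max y ε) - P.rhs A v (max y ε)‖
        ≤ 2 * P.rhsLip A ε * C * Real.exp (K * y) := by
      intro y hy
      rw [max_eq_left hy.1.le, Real.norm_eq_abs]
      refine abs_rhs_sub_le_of_weighted hμr hA hA' hε hu hv hC (by linarith) hy.1.le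
        fun s hs => ?_
      simpa [hρ, max_eq_left hs.1] using h s
    rw [← Real.norm_eq_abs]
    refine (intervalIntegral.norm_integral_le_of_norm_le hxε.le (Eventually.of_forall hb)
      (Continuous.intervalIntegrable (by fun_prop) _ _)).trans ?_
    refine (integral_const_mul_exp_le (by positivity) hK0 ε x).trans ?_
    simp only [hρ, max_eq_left hx0.le]
    refine mul_le_mul_of_nonneg_right ?_ (Real.exp_pos _).le
    rw [div_le_div_iff₀ hK0 two_pos, hK]
    nlinarith [mul_nonneg hC hl.le]
  have hS0 : ∃ C, ∀ x, |S 0 x| ≤ C * ρ x := by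
    refine ⟨|B| + 2 / (P.σ ^ 2 * ε ^ 2) * (P.lam / A ^ 2) / K, fun x => ?_⟩
    have hs := P.σ_pos
    set Q := 2 / (P.σ ^ 2 * ε ^ 2) * (P.lam / A ^ 2) with hQ
    have hQ0 : 0 < Q := by positivity
    have h1 : |w₀ (min x ε)| ≤ |B| := (hB _ (min_le_right _ _)).trans (le_abs_self _)
    have h2 : |∫ y in ε..max x ε, P.rhs A 0 (max y ε)| ≤ Q * |max x ε - ε| := by
      rw [← Real.norm_eq_abs]
      refine intervalIntegral.norm_integral_le_of_norm_le_const fun y hy => ?_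
      have hy' : ε ≤ max y ε := le_max_right _ _
      have hJ := abs_J_sub_le hA hA' (P.MD 0 (max y ε)) 0 0 0
      have hJ0 : P.J A 0 0 = 0 := by
        have h0 : (fun θ : ℝ => (0 : ℝ) / θ ^ 2 - 0 / θ) = fun _ => 0 := by ext; simp
        have := J_nonempty (P := P) 0 0 hA'
        unfold J
        rw [h0] at this ⊢
        rw [(image_nonempty.1 this).image_const, csInf_singleton]
      have hM := P.MD_zero_le (by linarith : 0 ≤ max y ε)
      simp only [rhs, Pi.zero_apply, mul_zero, sub_zero, Real.norm_eq_abs, abs_mul, hJ0, abs_zero,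
        zero_div, add_zero] at hJ ⊢
      rw [abs_of_pos (by positivity : 0 < 2 / (P.σ ^ 2 * max y ε ^ 2)), hQ]
      gcongr
      exact hJ.trans (by gcongr)
    have h3 : |max x ε - ε| ≤ max x 0 := by
      rw [abs_of_nonneg (by simp)]
      rcases le_total x ε with h | h
      · simp [h]
      · rw [max_eq_left h, max_eq_left (by linarith)]; linarith
    have h4 : K * max x 0 ≤ ρ x := by
      have := Real.add_one_le_exp (K * max x 0)
      linarith
    have h5 : |B| ≤ |B| * ρ x := le_mul_of_one_le_right (abs_nonneg _) (hρ1 x)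
    have h6 : Q * |max x ε - ε| ≤ Q / K * ρ x := by
      calc Q * |max x ε - ε| ≤ Q * max x 0 := by gcongr
        _ = Q / K * (K * max x 0) := by field_simp
        _ ≤ _ := by gcongr
    calc |S 0 x| ≤ _ := abs_add_le _ _
      _ ≤ _ := by rw [add_mul]; linarith
  obtain ⟨w, hw, hfix⟩ := exists_fixedPoint_of_weighted_contraction (ρ := ρ) (by fun_prop)
    (fun x => Real.exp_pos _) S
    (fun u hu => by
      have hd : Continuous fun x => ∫ y in ε..x, P.rhs A u (max y ε) :=
        intervalIntegral.continuous_primitive (fun a b => (hR u hu).intervalIntegrable a b) ε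
      exact (hw₀.comp (by fun_prop)).add (hd.comp (by fun_prop)))
    hlip hS0
  refine ⟨w, hw, fun x hx => ?_, fun x hx => ?_⟩
  · rw [← hfix]
    simp [S, hx]
  · have h := (hprim w hw x).hasDerivWithinAt (s := Ici ε)
    rw [max_eq_left hx] at h
    have hS : ∀ y ∈ Ici ε, w y = w₀ ε + ∫ z in ε..y, P.rhs A w (max z ε) := by
      intro y hy
      have hy' : ε ≤ y := hy
      conv_lhs => rw [← hfix]
      simp [S, hy']
    exact h.congr hS (hS x hx)

/-- Uniqueness for the truncated equation. -/
theorem eqOn_of_solutions (hμr : P.r < P.μ) (hA : 0 < A) (hA' : A < P.a) (hε : 0 < ε)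
    {u v : ℝ → ℝ} {N : ℝ} (hN : ε ≤ N) (hu : Continuous u) (hv : Continuous v)
    (h0 : ∀ x ∈ Icc 0 ε, u x = v x)
    (hu' : ∀ x ∈ Ico ε N, HasDerivWithinAt u (P.rhs A u x) (Ici x) x)
    (hv' : ∀ x ∈ Ico ε N, HasDerivWithinAt v (P.rhs A v x) (Ici x) x) :
    ∀ x ∈ Icc 0 N, u x = v x := by
  have hL := rhsLip_pos hμr hA hε
  have hl := P.lam_pos
  set K := P.lam + 4 * P.rhsLip A ε with hK
  have hK0 : 0 < K := by positivity
  obtain ⟨x₀, hx₀, hmax⟩ := isCompact_Icc.exists_isMaxOn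
    (⟨0, le_rfl, by linarith⟩ : (Icc 0 N).Nonempty)
    (f := fun x => |u x - v x| * Real.exp (-(K * x))) (by fun_prop)
  set C := |u x₀ - v x₀| * Real.exp (-(K * x₀)) with hC
  have hC0 : 0 ≤ C := by positivity
  have hle : ∀ y ∈ Icc 0 N, |u y - v y| ≤ C * Real.exp (K * y) := by
    intro y hy
    have : |u y - v y| * Real.exp (-(K * y)) ≤ C := hmax hy
    rwa [Real.exp_neg, ← div_eq_mul_inv, div_le_iff₀ (Real.exp_pos _)] at this
  have hhalf : ∀ x ∈ Icc ε N, ‖u x - v x‖ ≤ C / 2 * Real.exp (K * x) := by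
    refine image_norm_le_of_norm_deriv_right_le_deriv_boundary
      (f := fun x => u x - v x) (f' := fun x => P.rhs A u x - P.rhs A v x)
      (by fun_prop) (fun x hx => (hu' x hx).sub (hv' x hx)) ?_
      (hasDerivAt_const_mul_exp (C / 2) K) ?_
    · rw [h0 ε ⟨hε.le, le_rfl⟩, sub_self, norm_zero]
      positivity
    · intro x hx
      rw [Real.norm_eq_abs]
      refine (abs_rhs_sub_le_of_weighted hμr hA hA' hε hu hv hC0 (by linarith : P.lam ≤ K) hx.1
        fun y hy => hle y ⟨hy.1, hy.2.trans hx.2.le⟩).trans ?_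
      refine mul_le_mul_of_nonneg_right ?_ (Real.exp_pos _).le
      rw [hK]
      nlinarith [mul_nonneg hC0 hl.le]
  -- The largest weighted difference `C` is either attained where the functions agree or bounded by
  -- `C / 2`.
  have hCz : C = 0 := by
    rcases le_total x₀ ε with h | h
    · rw [hC, h0 x₀ ⟨hx₀.1, h⟩]; simp
    · have := hhalf x₀ ⟨h, hx₀.2⟩
      rw [Real.norm_eq_abs] at this
      have h2 : C ≤ C / 2 := by
        calc C ≤ C / 2 * Real.exp (K * x₀) * Real.exp (-(K * x₀)) := by
              rw [hC]; gcongr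
          _ = C / 2 := by rw [mul_assoc, ← Real.exp_add]; simp
      linarith
  intro x hx
  have := hle x hx
  rw [hCz, zero_mul] at this
  exact sub_eq_zero.1 (abs_nonpos_iff.1 this)

end Model

/-! ### The integrating factor of the equation singular at `0`. -/

/-- An increasing function with `k' = k q / (κ x²)`, where `q(x) = c + q₁ x`. -/
noncomputable def expKer (κ c q₁ x : ℝ) : ℝ := x ^ (q₁ / κ) * Real.exp (-(c / (κ * x)))

/-- The derivative of `expKer`. -/
noncomputable def expKerDeriv (κ c q₁ x : ℝ) : ℝ := expKer κ c q₁ x * ((c + q₁ * x) / (κ * x ^ 2))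

/-- The average of `h` over `[0,x]` against the measure with distribution function `expKer`. -/
noncomputable def expKerAverage (κ c q₁ : ℝ) (h : ℝ → ℝ) (x : ℝ) : ℝ :=
  (∫ y in (0 : ℝ)..x, h y * expKerDeriv κ c q₁ y) / expKer κ c q₁ x

section

variable {κ c q₁ : ℝ}

theorem expKer_pos {x : ℝ} (hx : 0 < x) : 0 < expKer κ c q₁ x :=
  mul_pos (Real.rpow_pos_of_pos hx _) (Real.exp_pos _)

theorem expKer_zero (hκ : 0 < κ) (hq : 0 < q₁) : expKer κ c q₁ 0 = 0 := by
  -- At `0` the exponential factor has the value `1`, since `c / 0 = 0`; the power is what vanishes.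
  rw [expKer, Real.zero_rpow (by positivity), zero_mul]

theorem hasDerivAt_expKer (hκ : 0 < κ) {x : ℝ} (hx : 0 < x) :
    HasDerivAt (expKer κ c q₁) (expKerDeriv κ c q₁ x) x := by
  have h1 := Real.hasDerivAt_rpow_const (x := x) (p := q₁ / κ) (Or.inl hx.ne')
  have h2 : HasDerivAt (fun y => -(c / (κ * y))) (c / (κ * x ^ 2)) x := by
    have := ((hasDerivAt_inv hx.ne').const_mul (c / κ)).neg
    refine (this.congr_deriv ?_).congr_of_eventuallyEq (Eventually.of_forall fun y => ?_)
    · field_simp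
    · simp only [Pi.neg_apply]; rw [← div_div, div_eq_mul_inv (c / κ)]
  refine (h1.mul h2.exp).congr_deriv ?_
  rw [expKerDeriv, expKer, Real.rpow_sub_one hx.ne']
  field_simp
  ring

theorem expKerDeriv_pos (hκ : 0 < κ) (hc : 0 < c) (hq : 0 < q₁) {x : ℝ} (hx : 0 < x) : 0 < expKerDeriv κ c q₁ x := by
  have := expKer_pos (κ := κ) (c := c) (q₁ := q₁) hx
  unfold expKerDeriv
  positivity

theorem continuousWithinAt_expKer_zero (hκ : 0 < κ) (hc : 0 < c) (hq : 0 < q₁) : ContinuousWithinAt (expKer κ c q₁) (Ici 0) 0 := by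
  have h1 : Tendsto (fun x : ℝ => x ^ (q₁ / κ)) (𝓝[Ici 0] 0) (𝓝 0) := by
    have := (Real.continuous_rpow_const (by positivity : 0 ≤ q₁ / κ)).tendsto 0
    rw [Real.zero_rpow (by positivity)] at this
    exact this.mono_left nhdsWithin_le_nhds
  rw [ContinuousWithinAt, expKer_zero hκ hq]
  refine squeeze_zero' ?_ ?_ h1
  · exact eventually_nhdsWithin_of_forall fun x hx =>
      mul_nonneg (Real.rpow_nonneg hx _) (Real.exp_pos _).le
  · refine eventually_nhdsWithin_of_forall fun x hx => ?_
    have hx' : 0 ≤ x := hx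
    refine mul_le_of_le_one_right (Real.rpow_nonneg hx _) (Real.exp_le_one_iff.2 ?_)
    rw [neg_nonpos]
    positivity

theorem continuousOn_expKer (hκ : 0 < κ) (hc : 0 < c) (hq : 0 < q₁) : ContinuousOn (expKer κ c q₁) (Ici 0) := by
  intro x hx
  rcases eq_or_lt_of_le (mem_Ici.1 hx) with rfl | h
  · exact continuousWithinAt_expKer_zero hκ hc hq
  · exact (hasDerivAt_expKer hκ h).continuousAt.continuousWithinAt

theorem continuousOn_expKerDeriv (hκ : 0 < κ) : ContinuousOn (expKerDeriv κ c q₁) (Ioi 0) := by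
  intro x hx
  have hx' : 0 < x := hx
  have h0 : κ * x ^ 2 ≠ 0 := by positivity
  have h1 := (hasDerivAt_expKer (c := c) (q₁ := q₁) hκ hx').continuousAt
  exact (h1.mul (by fun_prop (disch := assumption))).continuousWithinAt

theorem intervalIntegrable_expKerDeriv (hκ : 0 < κ) (hc : 0 < c) (hq : 0 < q₁) {x : ℝ}
    (hx : 0 ≤ x) : IntervalIntegrable (expKerDeriv κ c q₁) volume 0 x := by
  rw [intervalIntegrable_iff_integrableOn_Ioc_of_le hx]
  exact intervalIntegral.integrableOn_deriv_of_nonneg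
    ((continuousOn_expKer hκ hc hq).mono Icc_subset_Ici_self)
    (fun y hy => hasDerivAt_expKer hκ hy.1) fun y hy => (expKerDeriv_pos hκ hc hq hy.1).le

theorem integral_expKerDeriv (hκ : 0 < κ) (hc : 0 < c) (hq : 0 < q₁) {x : ℝ} (hx : 0 ≤ x) :
    ∫ y in (0 : ℝ)..x, expKerDeriv κ c q₁ y = expKer κ c q₁ x := by
  rw [intervalIntegral.integral_eq_sub_of_hasDerivAt_of_le hx
    ((continuousOn_expKer hκ hc hq).mono Icc_subset_Ici_self)
    (fun y hy => hasDerivAt_expKer hκ hy.1) (intervalIntegrable_expKerDeriv hκ hc hq hx),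
    expKer_zero hκ hq, sub_zero]

variable {h : ℝ → ℝ}

theorem intervalIntegrable_mul_expKerDeriv (hκ : 0 < κ) (hc : 0 < c) (hq : 0 < q₁)
    (hh : ContinuousOn h (Ici 0)) {x : ℝ} (hx : 0 ≤ x) :
    IntervalIntegrable (fun y => h y * expKerDeriv κ c q₁ y) volume 0 x :=
  (intervalIntegrable_expKerDeriv hκ hc hq hx).continuousOn_mul
    (hh.mono (by rw [uIcc_of_le hx]; exact Icc_subset_Ici_self))

theorem hasDerivAt_integral_mul_expKerDeriv (hκ : 0 < κ) (hc : 0 < c) (hq : 0 < q₁)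
    (hh : ContinuousOn h (Ici 0)) {x : ℝ} (hx : 0 < x) :
    HasDerivAt (fun x => ∫ y in (0 : ℝ)..x, h y * expKerDeriv κ c q₁ y)
      (h x * expKerDeriv κ c q₁ x) x := by
  have hcont : ContinuousOn (fun y => h y * expKerDeriv κ c q₁ y) (Ioi 0) :=
    (hh.mono Ioi_subset_Ici_self).mul (continuousOn_expKerDeriv hκ)
  exact intervalIntegral.integral_hasDerivAt_right
    (intervalIntegrable_mul_expKerDeriv hκ hc hq hh hx.le)
    (hcont.stronglyMeasurableAtFilter isOpen_Ioi x hx) (hcont.continuousAt (Ioi_mem_nhds hx))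

theorem tendsto_integral_mul_expKerDeriv (hκ : 0 < κ) (hc : 0 < c) (hq : 0 < q₁)
    (hh : ContinuousOn h (Ici 0)) :
    Tendsto (fun x => ∫ y in (0 : ℝ)..x, h y * expKerDeriv κ c q₁ y) (𝓝[>] 0) (𝓝 0) := by
  have h1 := intervalIntegral.continuousOn_primitive_interval'
    (intervalIntegrable_mul_expKerDeriv hκ hc hq hh zero_le_one) (left_mem_uIcc (a := (0 : ℝ)))
  have h2 := h1 0 left_mem_uIcc
  rw [uIcc_of_le zero_le_one, ContinuousWithinAt, intervalIntegral.integral_same] at h2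
  exact h2.mono_left (nhdsWithin_le_of_mem
    (mem_of_superset (Ioo_mem_nhdsGT zero_lt_one) Ioo_subset_Icc_self))

theorem tendsto_expKer (hκ : 0 < κ) (hc : 0 < c) (hq : 0 < q₁) :
    Tendsto (expKer κ c q₁) (𝓝[>] 0) (𝓝 0) := by
  have := (continuousWithinAt_expKer_zero hκ hc hq).tendsto
  rw [expKer_zero hκ hq] at this
  exact this.mono_left (nhdsWithin_mono _ Ioi_subset_Ici_self)

/-- By the quotient rule and `k' / k = (c + q₁ x)/(κ x²)`, the average `y` solves `κ x² y' + (c + q₁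
x) y = (c + q₁ x) h`. -/
theorem hasDerivAt_expKerAverage (hκ : 0 < κ) (hc : 0 < c) (hq : 0 < q₁)
    (hh : ContinuousOn h (Ici 0)) {x : ℝ} (hx : 0 < x) :
    HasDerivAt (expKerAverage κ c q₁ h)
      ((c + q₁ * x) / (κ * x ^ 2) * (h x - expKerAverage κ c q₁ h x)) x := by
  have hk := expKer_pos (κ := κ) (c := c) (q₁ := q₁) hx
  refine ((hasDerivAt_integral_mul_expKerDeriv hκ hc hq hh hx).div
    (hasDerivAt_expKer hκ hx) hk.ne').congr_deriv ?_
  rw [expKerAverage, expKerDeriv]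
  field_simp

/-- L'Hôpital's rule: the quotient of the derivatives is `h` itself. -/
theorem tendsto_expKerAverage (hκ : 0 < κ) (hc : 0 < c) (hq : 0 < q₁)
    (hh : ContinuousOn h (Ici 0)) : Tendsto (expKerAverage κ c q₁ h) (𝓝[>] 0) (𝓝 (h 0)) := by
  refine HasDerivAt.lhopital_zero_nhdsGT
    (eventually_nhdsWithin_of_forall fun x hx => hasDerivAt_integral_mul_expKerDeriv hκ hc hq hh hx)
    (eventually_nhdsWithin_of_forall fun x hx => hasDerivAt_expKer hκ hx)
    (eventually_nhdsWithin_of_forall fun x hx => (expKerDeriv_pos hκ hc hq hx).ne')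
    (tendsto_integral_mul_expKerDeriv hκ hc hq hh) (tendsto_expKer hκ hc hq) ?_
  refine ((hh 0 self_mem_Ici).mono_left (nhdsWithin_mono _ Ioi_subset_Ici_self)).congr' ?_
  exact eventually_nhdsWithin_of_forall fun x hx =>
    (mul_div_cancel_right₀ _ (expKerDeriv_pos hκ hc hq hx).ne').symm

/-- The weight is a positive density of total mass one on `(0,x]`, so averaging does not increase
uniform distances. -/
theorem abs_expKerAverage_sub_le (hκ : 0 < κ) (hc : 0 < c) (hq : 0 < q₁) {g : ℝ → ℝ}
    (hg : ContinuousOn g (Ici 0)) (hh : ContinuousOn h (Ici 0)) {x B : ℝ} (hx : 0 < x)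
    (hB : ∀ y ∈ Ioc 0 x, |g y - h y| ≤ B) :
    |expKerAverage κ c q₁ g x - expKerAverage κ c q₁ h x| ≤ B := by
  have hk := expKer_pos (κ := κ) (c := c) (q₁ := q₁) hx
  rw [expKerAverage, expKerAverage, ← sub_div, abs_div, abs_of_pos hk, div_le_iff₀ hk,
    ← intervalIntegral.integral_sub (intervalIntegrable_mul_expKerDeriv hκ hc hq hg hx.le)
      (intervalIntegrable_mul_expKerDeriv hκ hc hq hh hx.le),
    ← integral_expKerDeriv hκ hc hq hx.le, ← intervalIntegral.integral_const_mul,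
    ← Real.norm_eq_abs]
  refine intervalIntegral.norm_integral_le_of_norm_le hx.le
    (Eventually.of_forall fun y hy => ?_) ((intervalIntegrable_expKerDeriv hκ hc hq hx.le).const_mul B)
  have hd := expKerDeriv_pos hκ hc hq hy.1
  rw [← sub_mul, Real.norm_eq_abs, abs_mul, abs_of_pos hd]
  exact mul_le_mul_of_nonneg_right (hB y hy) hd.le

/-- The derivative of the average of a `C¹` function at `0+`. -/
theorem tendsto_deriv_expKerAverage (hκ : 0 < κ) (hc : 0 < c) (hq : 0 < q₁) {h' : ℝ → ℝ} {l : ℝ}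
    (hh : ContinuousOn h (Ici 0)) (hd : ∀ x, 0 < x → HasDerivAt h (h' x) x)
    (hl : Tendsto h' (𝓝[>] 0) (𝓝 l)) :
    Tendsto (fun x => (c + q₁ * x) / (κ * x ^ 2) * (h x - expKerAverage κ c q₁ h x))
      (𝓝[>] 0) (𝓝 l) := by
  -- `e` is the derivative of `κ x² / (c + q₁ x)`. With `k` denoting `expKer`, the quantity is `(h k
  -- - ∫ h k') / (k κ x² / (c + q₁ x))`, and the derivatives of its two parts are `h' k` and `k (1 +
  -- e)`.
  set e : ℝ → ℝ := fun x => κ * x * (2 * c + q₁ * x) / (c + q₁ * x) ^ 2 with he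
  have he0 : ∀ x, 0 < x → 0 < 1 + e x := fun x hx => by simp only [he]; positivity
  have hlim := HasDerivAt.lhopital_zero_nhdsGT (a := 0) (l := 𝓝 l)
    (f := fun x => h x * expKer κ c q₁ x - ∫ y in (0 : ℝ)..x, h y * expKerDeriv κ c q₁ y)
    (f' := fun x => h' x * expKer κ c q₁ x)
    (g := fun x => expKer κ c q₁ x * (κ * x ^ 2 / (c + q₁ * x)))
    (g' := fun x => expKer κ c q₁ x * (1 + e x))
    (eventually_nhdsWithin_of_forall fun x hx => ?_)
    (eventually_nhdsWithin_of_forall fun x hx => ?_)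
    (eventually_nhdsWithin_of_forall fun x hx => ?_) ?_ ?_ ?_
  · refine hlim.congr' (eventually_nhdsWithin_of_forall fun x hx => ?_)
    have hx' : 0 < x := hx
    have hk := expKer_pos (κ := κ) (c := c) (q₁ := q₁) hx'
    have hqx : 0 < c + q₁ * x := by positivity
    simp only [expKerAverage]
    field_simp
  · refine (((hd x hx).mul (hasDerivAt_expKer hκ hx)).sub
      (hasDerivAt_integral_mul_expKerDeriv hκ hc hq hh hx)).congr_deriv ?_
    ring
  · have hx' : 0 < x := hx
    have hqx : 0 < c + q₁ * x := by positivity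
    have h1 := (((hasDerivAt_pow 2 x).const_mul κ).div
      (((hasDerivAt_id' x).const_mul q₁).const_add c) hqx.ne')
    refine ((hasDerivAt_expKer hκ hx).mul h1).congr_deriv ?_
    simp only [expKerDeriv, he, Pi.div_apply]
    field_simp
    ring
  · exact (mul_pos (expKer_pos hx) (he0 x hx)).ne'
  · have h0 := (hh 0 self_mem_Ici).tendsto.mono_left (nhdsWithin_mono _ Ioi_subset_Ici_self)
    have := (h0.mul (tendsto_expKer hκ hc hq)).sub (tendsto_integral_mul_expKerDeriv hκ hc hq hh)
    simpa using this
  · have h0 : c + q₁ * 0 ≠ 0 := by simpa using hc.ne'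
    have hcont : ContinuousAt (fun x => κ * x ^ 2 / (c + q₁ * x)) 0 := by
      fun_prop (disch := assumption)
    have h1 := hcont.tendsto.mono_left (nhdsWithin_le_nhds (s := Ioi 0))
    simpa using (tendsto_expKer hκ hc hq).mul h1
  · have h0 : (c + q₁ * 0) ^ 2 ≠ 0 := by simpa using hc.ne'
    have h2 : 1 + e 0 ≠ 0 := by simp [he]
    have hcont : ContinuousAt e 0 := by
      simp only [he]
      fun_prop (disch := assumption)
    have h1 : Tendsto (fun x => 1 + e x) (𝓝[>] 0) (𝓝 1) := by
      have := (hcont.tendsto.mono_left (nhdsWithin_le_nhds (s := Ioi 0))).const_add 1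
      simpa [he] using this
    have h3 := hl.div h1 one_ne_zero
    rw [div_one] at h3
    refine h3.congr' (eventually_nhdsWithin_of_forall fun x hx => ?_)
    have := expKer_pos (κ := κ) (c := c) (q₁ := q₁) hx
    exact (mul_div_mul_left _ _ this.ne').symm.trans (by rw [mul_comm (expKer κ c q₁ x) (h' x)])

end

/-! ### Construction of `V_γ`. -/

/-- A criterion for being twice continuously differentiable on the half-line. -/
theorem contDiffOn_two_of_hasDerivAt {V w z : ℝ → ℝ} (hV : ∀ x, 0 < x → HasDerivAt V (w x) x)
    (hw : ∀ x, 0 < x → HasDerivAt w (z x) x) (hz : ContinuousOn z (Ioi 0)) :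
    ContDiffOn ℝ 2 V (Ioi 0) := by
  rw [show (2 : WithTop ℕ∞) = 1 + 1 by norm_num, contDiffOn_succ_iff_deriv_of_isOpen isOpen_Ioi]
  refine ⟨fun x hx => (hV x hx).differentiableAt.differentiableWithinAt, by simp, ?_⟩
  have h1 : ContDiffOn ℝ 1 w (Ioi 0) := by
    rw [show (1 : WithTop ℕ∞) = 0 + 1 by norm_num, contDiffOn_succ_iff_deriv_of_isOpen isOpen_Ioi]
    refine ⟨fun x hx => (hw x hx).differentiableAt.differentiableWithinAt, by simp, ?_⟩
    rw [contDiffOn_zero]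
    exact hz.congr fun x hx => (hw x hx).deriv
  exact h1.congr fun x hx => (hV x hx).deriv

namespace Model

/-- Existence of `V_γ`. -/
theorem exists_isVgamma (P : Model) (hμr : P.r < P.μ) {γ : ℝ} (hγ : 0 < γ) :
    ∃ V, P.IsVgamma γ V := by
  have hs := P.σ_pos
  have hc := P.c_pos
  have hr := P.r_pos
  have hl := P.lam_pos
  have hk : 0 < P.μ - P.r := sub_pos.2 hμr
  -- With these constants the equation for `u = V'` reads `κ x² u' + (c + q₁ x) u = MD u`.
  obtain ⟨κ, hκdef⟩ : ∃ κ, κ = P.σ ^ 2 * γ ^ 2 / 2 := ⟨_, rfl⟩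
  obtain ⟨q₁, hqdef⟩ : ∃ q₁, q₁ = P.r + γ * (P.μ - P.r) := ⟨_, rfl⟩
  have hκ : 0 < κ := by rw [hκdef]; positivity
  have hq : 0 < q₁ := by rw [hqdef]; positivity
  have hqx : ∀ x, 0 ≤ x → P.c ≤ P.c + q₁ * x := fun x hx => by
    have : 0 ≤ q₁ * x := by positivity
    linarith
  have hqx0 : ∀ x, 0 ≤ x → 0 < P.c + q₁ * x := fun x hx => hc.trans_le (hqx x hx)
  let H : (ℝ → ℝ) → ℝ → ℝ := fun u y => P.MD u y / (P.c + q₁ * y)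
  have hH : ∀ u, Continuous u → ContinuousOn (H u) (Ici 0) := fun u hu =>
    (P.continuous_MD hu).continuousOn.div (by fun_prop) fun x hx => (hqx0 x hx).ne'
  have hH0 : ∀ u, H u 0 = P.lam / P.c := fun u => by simp [H, MD]
  -- Every `H u` has the value `λ/c` at `0`, so this extension to the left is continuous and the
  -- fixed point has the required `V'(0+)`.
  let S : (ℝ → ℝ) → ℝ → ℝ := fun u x =>
    if x ≤ 0 then P.lam / P.c else expKerAverage κ P.c q₁ (H u) x
  have hSpos : ∀ u x, 0 < x → S u x = expKerAverage κ P.c q₁ (H u) x := fun u x hx =>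
    if_neg (not_le.2 hx)
  have hSneg : ∀ u x, x ≤ 0 → S u x = P.lam / P.c := fun u x hx => if_pos hx
  have hSd : ∀ u, Continuous u → ∀ x, 0 < x → HasDerivAt (S u)
      ((P.c + q₁ * x) / (κ * x ^ 2) * (H u x - S u x)) x := fun u hu x hx => by
    rw [hSpos u x hx]
    refine (hasDerivAt_expKerAverage hκ hc hq (hH u hu) hx).congr_of_eventuallyEq ?_
    filter_upwards [Ioi_mem_nhds hx] with y hy using hSpos u y hy
  have hScont : ∀ u, Continuous u → Continuous (S u) := by
    intro u hu
    rw [continuous_iff_continuousAt]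
    intro x
    rcases lt_trichotomy x 0 with hx | rfl | hx
    · exact continuousAt_const.congr (f := fun _ => P.lam / P.c)
        (by filter_upwards [Iio_mem_nhds hx] with y hy using (hSneg u y (le_of_lt hy)).symm)
    · rw [continuousAt_iff_continuous_left'_right']
      constructor
      · rw [ContinuousWithinAt, hSneg u 0 le_rfl]
        exact tendsto_const_nhds.congr'
          (eventually_nhdsWithin_of_forall fun y hy => (hSneg u y (le_of_lt hy)).symm)
      · rw [ContinuousWithinAt, hSneg u 0 le_rfl, ← hH0 u]
        exact (tendsto_expKerAverage hκ hc hq (hH u hu)).congr'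
          (eventually_nhdsWithin_of_forall fun y hy => (hSpos u y hy).symm)
    · exact (hSd u hu x hx).continuousAt
  -- This rate makes `λ / (K c) = 1/2`, the contraction factor.
  set K := 2 * P.lam / P.c with hK
  have hK0 : 0 < K := by positivity
  set ρ : ℝ → ℝ := fun y => Real.exp (K * max y 0) with hρ
  have hρ1 : ∀ y, 1 ≤ ρ y := fun y => Real.one_le_exp (by positivity)
  obtain ⟨u, hu, hfix⟩ := exists_fixedPoint_of_weighted_contraction (ρ := ρ) (by fun_prop)
    (fun x => Real.exp_pos _) S hScont
    (by
      intro u v C hu hv hC h x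
      rcases le_or_gt x 0 with hx | hx
      · rw [hSneg u x hx, hSneg v x hx, sub_self, abs_zero]
        have := hρ1 x
        positivity
      rw [hSpos u x hx, hSpos v x hx]
      refine abs_expKerAverage_sub_le hκ hc hq (hH u hu) (hH v hv) hx fun y hy => ?_
      have h1 := P.abs_MD_sub_le hu hv (g := fun s => C * Real.exp (K * s)) (by fun_prop) hy.1.le
        fun s hs => by simpa [hρ, max_eq_left hs.1] using h s
      have h2 := (h1.trans (mul_le_mul_of_nonneg_left
        (integral_const_mul_exp_le hC hK0 0 y) hl.le))
      simp only [H]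
      rw [← sub_div, abs_div, abs_of_pos (hqx0 y hy.1.le), div_le_iff₀ (hqx0 y hy.1.le)]
      calc |P.MD u y - P.MD v y| ≤ P.lam * (C / K * Real.exp (K * y)) := h2
        _ = C / 2 * Real.exp (K * y) * P.c := by rw [hK]; field_simp
        _ ≤ C / 2 * ρ x * (P.c + q₁ * y) := by
          have h3 := hqx y hy.1.le
          have h4 : Real.exp (K * y) ≤ ρ x := by
            simp only [hρ, max_eq_left hx.le]
            gcongr
            exact hy.2
          gcongr)
    (by
      refine ⟨P.lam / P.c, fun x => ?_⟩
      have hle : P.lam / P.c ≤ P.lam / P.c * ρ x := le_mul_of_one_le_right (by positivity) (hρ1 x)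
      refine le_trans ?_ hle
      rcases le_or_gt x 0 with hx | hx
      · rw [hSneg 0 x hx, abs_of_pos (by positivity)]
      · rw [hSpos 0 x hx]
        have := abs_expKerAverage_sub_le (κ := κ) (c := P.c) (q₁ := q₁) (h := 0) hκ hc hq
          (hH 0 continuous_zero) continuousOn_const hx (B := P.lam / P.c) fun y hy => by
            simp only [H, Pi.zero_apply, sub_zero]
            rw [abs_div, abs_of_pos (hqx0 y hy.1.le)]
            exact div_le_div₀ hl.le (P.MD_zero_le hy.1.le) hc (hqx y hy.1.le)
        simpa [expKerAverage] using this)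
  have hu0 : u 0 = P.lam / P.c := by rw [← hfix, hSneg u 0 le_rfl]
  set z : ℝ → ℝ := fun x => (P.c + q₁ * x) / (κ * x ^ 2) * (H u x - u x) with hz
  have hud : ∀ x, 0 < x → HasDerivAt u (z x) x := fun x hx => by
    have := hSd u hu x hx
    rwa [hfix] at this
  set V : ℝ → ℝ := fun x => 1 + ∫ y in (0 : ℝ)..x, u y with hV
  have hVd : ∀ x, HasDerivAt V (u x) x := fun x =>
    (hu.integral_hasStrictDerivAt 0 x).hasDerivAt.const_add 1
  have hV0 : Tendsto V (𝓝[>] 0) (𝓝 1) := by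
    have := (hVd 0).continuousAt.tendsto.mono_left (nhdsWithin_le_nhds (s := Ioi 0))
    simpa [hV] using this
  have hdV : deriv V = u := funext fun x => (hVd x).deriv
  have hzc : ContinuousOn z (Ioi 0) := by
    refine ContinuousOn.mul (fun x hx => ?_)
      (((hH u hu).mono Ioi_subset_Ici_self).sub hu.continuousOn)
    have : κ * x ^ 2 ≠ 0 := by
      have : 0 < x := hx
      positivity
    exact ContinuousAt.continuousWithinAt (by fun_prop (disch := assumption))
  refine ⟨V, contDiffOn_two_of_hasDerivAt (fun x _ => hVd x) hud hzc, fun x hx => ?_, hV0, ?_, ?_⟩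
  · have hM := P.M_eq_MD hu hx fun y _ => rfl
    have h1 := hqx0 x hx.le
    rw [L, hdV, (hud x hx).deriv, hM, hz]
    simp only [H]
    have e : P.c + P.r * x + (P.μ - P.r) * γ * x = P.c + q₁ * x := by rw [hqdef]; ring
    have e2 : P.σ ^ 2 * x ^ 2 * γ ^ 2 / 2 = κ * x ^ 2 := by rw [hκdef]; ring
    rw [e, e2]
    field_simp
    ring
  · rw [hdV, ← hu0]
    exact (hu.tendsto 0).mono_left nhdsWithin_le_nhds
  · rw [hdV]
    have hMd := P.hasDerivAt_MD hu
    have hconv := continuous_convolution hu P.continuous_density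
    have hden := P.continuous_density
    have hnum : Continuous fun x =>
        P.lam * (u x - P.density x - ∫ s in (0 : ℝ)..x, u s * P.density (x - s)) :=
      continuous_const.mul ((hu.sub hden).sub hconv)
    have hMc := P.continuous_MD hu
    have h0 : (P.c + q₁ * 0) ^ 2 ≠ 0 := by simpa using hc.ne'
    -- `z` is the derivative of an average of `H u`, so its limit at `0+` is that of `(H u)'`, which
    -- the quotient rule gives.
    refine (tendsto_deriv_expKerAverage (h := H u) (h' := fun x =>
      (P.lam * (u x - P.density x - ∫ s in (0 : ℝ)..x, u s * P.density (x - s)) * (P.c + q₁ * x)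
        - P.MD u x * q₁) / (P.c + q₁ * x) ^ 2) hκ hc hq (hH u hu) (fun x hx => ?_) ?_).congr' ?_
    · have := (hMd x).div (((hasDerivAt_id' x).const_mul q₁).const_add P.c) (hqx0 x hx.le).ne'
      rwa [mul_one] at this
    · have hcont : ContinuousAt (fun x =>
          (P.lam * (u x - P.density x - ∫ s in (0 : ℝ)..x, u s * P.density (x - s))
            * (P.c + q₁ * x) - P.MD u x * q₁) / (P.c + q₁ * x) ^ 2) 0 := by
        fun_prop (disch := assumption)
      have := hcont.tendsto.mono_left (nhdsWithin_le_nhds (s := Ioi 0))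
      convert this using 2
      have hM0 : P.MD u 0 = P.lam := by simp [MD]
      rw [hu0, P.density_of_nonneg le_rfl, hM0, ← hqdef]
      simp only [intervalIntegral.integral_same]
      field_simp
      ring
    · refine eventually_nhdsWithin_of_forall fun x hx => ?_
      have := hSpos u x hx
      rw [hfix] at this
      simp only [(hud x hx).deriv, hz, ← this]

end Model

/-! ### Barriers and bounds uniform in the cut-off. -/

/-- Take the least point of the compact set where `h ≤ 0`; the intermediate value theorem makes `h`
vanish there. -/
theorem exists_first_zero {h : ℝ → ℝ} {a b x : ℝ} (hc : ContinuousOn h (Icc a b)) (ha : 0 < h a)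
    (hx : x ∈ Icc a b) (hx0 : h x ≤ 0) : ∃ y ∈ Ioc a b, h y = 0 ∧ ∀ s ∈ Ico a y, 0 < h s := by
  have hcomp : IsCompact (Icc a b ∩ h ⁻¹' Iic 0) :=
    isCompact_Icc.of_isClosed_subset (hc.preimage_isClosed_of_isClosed isClosed_Icc isClosed_Iic)
      inter_subset_left
  obtain ⟨y, hy, hleast⟩ := hcomp.exists_isLeast ⟨x, hx, hx0⟩
  have hpos : ∀ s ∈ Ico a y, 0 < h s := fun s hs => by
    by_contra hcon
    exact (hleast ⟨⟨hs.1, hs.2.le.trans hy.1.2⟩, not_lt.1 hcon⟩).not_gt hs.2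
  have hay : a < y := lt_of_le_of_ne hy.1.1 (by rintro rfl; exact (not_lt.2 hy.2) ha)
  obtain ⟨s, hs, hs0⟩ := intermediate_value_Icc' hay.le
    (hc.mono (Icc_subset_Icc_right hy.1.2)) ⟨hy.2, ha.le⟩
  have : s = y := by
    by_contra hne
    exact (hpos s ⟨hs.1, lt_of_le_of_ne hs.2 hne⟩).ne' hs0
  exact ⟨y, ⟨hay, hy.1.2⟩, this ▸ hs0, hpos⟩

theorem deriv_nonpos_of_first_zero {h : ℝ → ℝ} {h' a y : ℝ} (hd : HasDerivAt h h' y) (hay : a < y)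
    (h0 : h y = 0) (hpos : ∀ s ∈ Ico a y, 0 < h s) : h' ≤ 0 := by
  have := (hasDerivWithinAt_iff_tendsto_slope' (s := Iio y) (by simp)).1 hd.hasDerivWithinAt
  refine le_of_tendsto this ?_
  filter_upwards [Ioo_mem_nhdsLT hay] with s hs
  rw [slope_def_field, h0, sub_zero]
  exact div_nonpos_of_nonneg_of_nonpos (hpos s ⟨hs.1.le, hs.2⟩).le (by linarith [hs.2])

namespace Model

variable {P : Model}

theorem exists_half_le_tail (P : Model) : ∃ β > 0, ∀ s ∈ Icc 0 β, 1 / 2 ≤ P.tail s := by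
  have h : ∀ᶠ s in 𝓝 0, 1 / 2 < P.tail s :=
    (P.continuous_tail.tendsto 0).eventually (lt_mem_nhds (by rw [tail_zero]; norm_num))
  obtain ⟨δ, hδ, hball⟩ := Metric.eventually_nhds_iff.1 h
  refine ⟨δ / 2, by positivity, fun s hs => (hball ?_).le⟩
  rw [Real.dist_eq, sub_zero, abs_of_nonneg hs.1]
  linarith [hs.2]

/-- All other contributions are nonnegative and are dropped. A window strictly on the left of `x`
lets past values of `w` bound the functional at `x`. -/
theorem le_MD {w : ℝ → ℝ} (hw : Continuous w) {p q x m : ℝ} (hp : 0 ≤ p) (hpq : p ≤ q)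
    (hqx : q ≤ x) (hw0 : ∀ s ∈ Icc 0 x, 0 ≤ w s) (hm0 : 0 ≤ m) (hm : ∀ s ∈ Icc p q, m ≤ w s)
    (ht : ∀ s ∈ Icc p q, 1 / 2 ≤ P.tail (x - s)) : P.lam * ((q - p) * (m / 2)) ≤ P.MD w x := by
  have hx : 0 ≤ x := by linarith
  have htc := P.continuous_tail
  have hint : ∀ a b, IntervalIntegrable (fun s => w s * P.tail (x - s)) volume a b := fun a b =>
    Continuous.intervalIntegrable (by fun_prop) _ _
  have hnn : ∀ s ∈ Icc 0 x, 0 ≤ w s * P.tail (x - s) := fun s hs =>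
    mul_nonneg (hw0 s hs) (P.tail_nonneg (sub_nonneg.2 hs.2))
  refine mul_le_mul_of_nonneg_left ?_ P.lam_pos.le
  rw [← intervalIntegral.integral_add_adjacent_intervals (hint 0 p) (hint p x),
    ← intervalIntegral.integral_add_adjacent_intervals (hint p q) (hint q x)]
  have h1 : 0 ≤ ∫ s in (0 : ℝ)..p, w s * P.tail (x - s) :=
    intervalIntegral.integral_nonneg hp fun s hs => hnn s ⟨hs.1, by linarith [hs.2]⟩
  have h2 : 0 ≤ ∫ s in q..x, w s * P.tail (x - s) :=
    intervalIntegral.integral_nonneg hqx fun s hs => hnn s ⟨by linarith [hs.1], hs.2⟩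
  have h3 : ∫ s in p..q, m / 2 ≤ ∫ s in p..q, w s * P.tail (x - s) := by
    refine intervalIntegral.integral_mono_on hpq intervalIntegrable_const (hint p q)
      fun s hs => ?_
    nlinarith [hm s hs, ht s hs]
  rw [intervalIntegral.integral_const, smul_eq_mul] at h3
  linarith [P.tail_nonneg hx]

/-- `tail x` may vanish, so positivity is drawn from a short window just before `x`, where the tail
factor is at least `1/2` and `w` is bounded below. -/
theorem MD_pos {w : ℝ → ℝ} (hw : Continuous w) {x : ℝ} (hx : 0 < x)
    (hpos : ∀ s ∈ Ico 0 x, 0 < w s) : 0 < P.MD w x := by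
  obtain ⟨β, hβ, hβt⟩ := P.exists_half_le_tail
  set γ := min β x with hγ
  have hγ0 : 0 < γ := lt_min hβ hx
  have hγβ : γ ≤ β := min_le_left _ _
  have hγx : γ ≤ x := min_le_right _ _
  obtain ⟨s₀, hs₀, hmin⟩ := isCompact_Icc.exists_isMinOn
    (nonempty_Icc.2 (by linarith : x - γ ≤ x - γ / 2)) hw.continuousOn
  have hm : 0 < w s₀ := hpos s₀ ⟨by linarith [hs₀.1], by linarith [hs₀.2]⟩
  have hw0 : ∀ s ∈ Icc 0 x, 0 ≤ w s := by
    have := closure_minimal (s := Ico 0 x) (t := {s | 0 ≤ w s})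
      (fun s hs => (hpos s hs).le) (isClosed_le continuous_const hw)
    rwa [closure_Ico hx.ne] at this
  have hle := le_MD (P := P) hw (p := x - γ) (q := x - γ / 2) (x := x) (by linarith) (by linarith)
    (by linarith) hw0 hm.le (fun s hs => hmin hs)
    (fun s hs => hβt _ ⟨by linarith [hs.2], by linarith [hs.1]⟩)
  refine lt_of_lt_of_le ?_ hle
  have := P.lam_pos
  have : 0 < x - γ / 2 - (x - γ) := by linarith
  positivity

set_option maxHeartbeats 1000000 in
/-- Bounds for solutions of the truncated equation that do not depend on the cut-off level. -/
theorem exists_apriori_bound (hμr : P.r < P.μ) {w₀ : ℝ → ℝ} (hw₀ : Continuous w₀) {ε N : ℝ}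
    (hε : 0 < ε) (hN : ε ≤ N) (hpos : ∀ x ∈ Icc 0 ε, 0 < w₀ x)
    (hD₀ : 0 < P.MD w₀ ε - (P.c + P.r * ε) * w₀ ε) :
    ∃ A₀ > 0, ∀ A, 0 < A → A ≤ A₀ → A < min P.a P.b → ∀ w, Continuous w →
      (∀ x ∈ Icc 0 ε, w x = w₀ x) → (∀ x, ε < x → HasDerivAt w (P.rhs A w x) x) →
      ∀ x ∈ Icc ε N, 0 < w x ∧ 0 < P.MD w x - (P.c + P.r * x) * w x ∧
        A₀ * ((P.μ - P.r) * x * w x) ≤ 2 * (P.MD w x - (P.c + P.r * x) * w x) := by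
  have hs := P.σ_pos
  have hc := P.c_pos
  have hr := P.r_pos
  have hl := P.lam_pos
  have ha := P.a_pos
  obtain ⟨k, hkdef⟩ : ∃ k, k = P.μ - P.r := ⟨_, rfl⟩
  have hk : 0 < k := by rw [hkdef]; exact sub_pos.2 hμr
  have hN0 : 0 < N := by linarith
  -- the constants
  obtain ⟨β', hβ', hβt'⟩ := P.exists_half_le_tail
  obtain ⟨β, hβ, hβε, hβt⟩ : ∃ β > 0, β ≤ ε ∧ ∀ s ∈ Icc 0 β, 1 / 2 ≤ P.tail s :=
    ⟨min β' ε, lt_min hβ' hε, min_le_right _ _, fun s hs =>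
      hβt' s ⟨hs.1, hs.2.trans (min_le_left _ _)⟩⟩
  obtain ⟨B₀, hB₀⟩ := isCompact_Icc.exists_bound_of_continuousOn (hw₀.continuousOn (s := Icc 0 ε))
  obtain ⟨s₀, hs₀, hmin⟩ := isCompact_Icc.exists_isMinOn (nonempty_Icc.2 hε.le) hw₀.continuousOn
  obtain ⟨m₀, hm₀def⟩ : ∃ m₀, m₀ = w₀ s₀ := ⟨_, rfl⟩
  have hm₀ : 0 < m₀ := hm₀def ▸ hpos s₀ hs₀
  have hm₀le : ∀ s ∈ Icc 0 ε, m₀ ≤ w₀ s := fun s hs => hm₀def ▸ hmin hs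
  have hB₀0 : 0 ≤ B₀ := (norm_nonneg _).trans (hB₀ s₀ hs₀)
  obtain ⟨f₁, hf₁'⟩ := isCompact_Icc.exists_bound_of_continuousOn
    (P.continuous_density.continuousOn (s := Icc 0 N))
  have hf₁ : 0 ≤ f₁ := (norm_nonneg _).trans (hf₁' 0 ⟨le_rfl, hN0.le⟩)
  -- `hK1` serves the upper barrier for `w`; `hK2` and `hK3` serve the lower one, for large and
  -- small `D` respectively.
  obtain ⟨K, hK1, hK2, hK3⟩ : ∃ K, 4 * P.lam ≤ K * P.c ∧ k ^ 2 < K * (P.σ ^ 2 * P.c) ∧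
      16 * (P.c + P.r * N) ≤ K * (P.lam * β ^ 2) := by
    refine ⟨max (4 * P.lam / P.c) (max (k ^ 2 / (P.σ ^ 2 * P.c) + 1)
      (16 * (P.c + P.r * N) / (P.lam * β ^ 2))), ?_, ?_, ?_⟩
    · rw [← div_le_iff₀ hc]; exact le_max_left _ _
    · rw [← div_lt_iff₀ (by positivity)]
      exact lt_max_of_lt_right (lt_max_of_lt_left (by linarith))
    · rw [← div_le_iff₀ (by positivity)]
      exact (le_max_right _ _).trans (le_max_right _ _)
  have hK0 : 0 < K := pos_of_mul_pos_left (by linarith : 0 < K * P.c) hc.le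
  obtain ⟨C, hC0, hCB, hCl⟩ : ∃ C, 0 < C ∧ B₀ < C ∧ 4 * P.lam ≤ C * P.c := by
    refine ⟨B₀ + 4 * P.lam / P.c, by positivity, by simp; positivity, ?_⟩
    rw [add_mul, div_mul_cancel₀ _ hc.ne']
    have := mul_nonneg hB₀0 hc.le
    linarith
  obtain ⟨η, hη, hηm⟩ : ∃ η, 0 < η ∧ η < m₀ := ⟨m₀ / 2, by positivity, by linarith⟩
  obtain ⟨wl, hwl⟩ : ∃ wl, wl = η * Real.exp (-K * N) := ⟨_, rfl⟩
  obtain ⟨wu, hwu⟩ : ∃ wu, wu = C * Real.exp (K * N) := ⟨_, rfl⟩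
  have hwl0 : 0 < wl := by rw [hwl]; positivity
  have hwu0 : 0 < wu := by rw [hwu]; positivity
  obtain ⟨Q, hQdef⟩ : ∃ Q, Q = P.lam * (f₁ + wu * f₁ * N) + P.r * wu := ⟨_, rfl⟩
  have hQ : 0 < Q := by rw [hQdef]; positivity
  -- `Q` bounds the terms of `D'` that could be negative. With this `t`, the term `-(c + r x) w'`
  -- outweighs them as soon as `2 D ≤ E t`; the choice of `δ` ensures this when `D = δ`.
  obtain ⟨t, ht, hta, htQ⟩ : ∃ t, 0 < t ∧ t ≤ P.a ∧ Q * (P.σ ^ 2 * N * t) < P.c * k * wl := by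
    refine ⟨min P.a (P.c * k * wl / (2 * Q * (P.σ ^ 2 * N))), lt_min ha (by positivity),
      min_le_left _ _, ?_⟩
    calc _ ≤ Q * (P.σ ^ 2 * N * (P.c * k * wl / (2 * Q * (P.σ ^ 2 * N)))) := by
          gcongr; exact min_le_right _ _
      _ = P.c * k * wl / 2 := by field_simp
      _ < _ := half_lt_self (by positivity)
  obtain ⟨δ, hδ, hδD, hδt⟩ : ∃ δ, 0 < δ ∧ δ < P.MD w₀ ε - (P.c + P.r * ε) * w₀ ε ∧
      2 * δ ≤ k * ε * wl * t := by
    refine ⟨min ((P.MD w₀ ε - (P.c + P.r * ε) * w₀ ε) / 2) (k * ε * wl * t / 2),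
      lt_min (by positivity) (by positivity), (min_le_left _ _).trans_lt (by linarith), ?_⟩
    have := min_le_right ((P.MD w₀ ε - (P.c + P.r * ε) * w₀ ε) / 2) (k * ε * wl * t / 2)
    linarith
  -- The first entry makes `θ = t` an admissible test point; the second gives `A₀ E ≤ 2 δ`.
  refine ⟨min t (2 * δ / (k * N * wu)), lt_min ht (by positivity), ?_⟩
  intro A hA hAA₀ hAab w hw hww₀ hw'
  have hAt : A ≤ t := hAA₀.trans (min_le_left _ _)
  have hAa : A < P.a := hAab.trans_le (min_le_left _ _)
  rw [← hkdef]
  set D : ℝ → ℝ := fun x => P.MD w x - (P.c + P.r * x) * w x with hD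
  have hDc : Continuous D := by
    have := P.continuous_MD hw
    simp only [hD]
    fun_prop
  have hexp : ∀ x, 0 ≤ x → C ≤ C * Real.exp (K * x) := fun x hx =>
    le_mul_of_one_le_right hC0.le (Real.one_le_exp (by positivity))
  have hexp' : ∀ x, 0 ≤ x → η * Real.exp (-K * x) ≤ η := fun x hx =>
    mul_le_of_le_one_right hη.le (Real.exp_le_one_iff.2 (by
      rw [neg_mul, neg_nonpos]; positivity))
  -- the barriers
  have key : ∀ x ∈ Icc ε N, 0 < min (C * Real.exp (K * x) - w x)
      (min (w x - η * Real.exp (-K * x)) (D x - δ)) := by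
    by_contra! hcon
    obtain ⟨x, hx, hx0⟩ := hcon
    have hinit : 0 < min (C * Real.exp (K * ε) - w ε)
        (min (w ε - η * Real.exp (-K * ε)) (D ε - δ)) := by
      have h1 := (hB₀ ε ⟨hε.le, le_rfl⟩)
      rw [Real.norm_eq_abs] at h1
      have h2 := hm₀le ε ⟨hε.le, le_rfl⟩
      have h3 : D ε = P.MD w₀ ε - (P.c + P.r * ε) * w₀ ε := by
        simp only [hD]
        rw [P.MD_congr hε.le hww₀, hww₀ ε ⟨hε.le, le_rfl⟩]
      simp only [lt_min_iff, sub_pos]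
      rw [hww₀ ε ⟨hε.le, le_rfl⟩, h3]
      refine ⟨?_, ?_, hδD⟩
      · linarith [hexp ε hε.le, (abs_le.1 h1).2]
      · linarith [hexp' ε hε.le]
    obtain ⟨x₁, hx₁, hzero, hbefore⟩ := exists_first_zero
      (h := fun x => min (C * Real.exp (K * x) - w x) (min (w x - η * Real.exp (-K * x)) (D x - δ)))
      (by fun_prop) hinit hx hx0
    have hx₁ε : ε < x₁ := hx₁.1
    have hx₁N : x₁ ≤ N := hx₁.2
    have hx₁0 : 0 < x₁ := by linarith
    have hb1 : ∀ s ∈ Ico ε x₁, w s < C * Real.exp (K * s) := fun s hs =>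
      sub_pos.1 (lt_min_iff.1 (hbefore s hs)).1
    have hb2 : ∀ s ∈ Ico ε x₁, η * Real.exp (-K * s) < w s := fun s hs =>
      sub_pos.1 (lt_min_iff.1 (lt_min_iff.1 (hbefore s hs)).2).1
    have hb3 : ∀ s ∈ Ico ε x₁, 0 < D s - δ := fun s hs =>
      (lt_min_iff.1 (lt_min_iff.1 (hbefore s hs)).2).2
    have hz := hzero.ge
    simp only [le_min_iff, sub_nonneg] at hz
    obtain ⟨hz1, hz2, hz3⟩ := hz
    have hle1 : ∀ s ∈ Icc 0 x₁, w s ≤ C * Real.exp (K * s) := by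
      intro s hs
      rcases le_or_gt s ε with h | h
      · have h1 := hB₀ s ⟨hs.1, h⟩
        rw [Real.norm_eq_abs] at h1
        rw [hww₀ s ⟨hs.1, h⟩]
        linarith [hexp s hs.1, (abs_le.1 h1).2]
      · rcases hs.2.lt_or_eq with h2 | rfl
        · exact (hb1 s ⟨h.le, h2⟩).le
        · exact hz1
    have hle2 : ∀ s ∈ Icc 0 x₁, η * Real.exp (-K * s) ≤ w s := by
      intro s hs
      rcases le_or_gt s ε with h | h
      · rw [hww₀ s ⟨hs.1, h⟩]
        linarith [hexp' s hs.1, hm₀le s ⟨hs.1, h⟩]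
      · rcases hs.2.lt_or_eq with h2 | rfl
        · exact (hb2 s ⟨h.le, h2⟩).le
        · exact hz2
    have hw0 : ∀ s ∈ Icc 0 x₁, 0 < w s := fun s hs => lt_of_lt_of_le (by positivity) (hle2 s hs)
    have hwx := hw0 x₁ ⟨hx₁0.le, le_rfl⟩
    have hDx : 0 < D x₁ := by linarith
    have hcr : 0 < P.c + P.r * x₁ := by positivity
    have hMDx : P.MD w x₁ = D x₁ + (P.c + P.r * x₁) * w x₁ := by simp only [hD]; ring
    have hrhs : P.rhs A w x₁ = 2 / (P.σ ^ 2 * x₁ ^ 2) * P.J A (D x₁) (k * x₁ * w x₁) := by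
      rw [hkdef]; rfl
    have hder := hw' x₁ hx₁ε
    have hcases : w x₁ = C * Real.exp (K * x₁) ∨ w x₁ = η * Real.exp (-K * x₁) ∨ D x₁ = δ := by
      rcases min_choice (C * Real.exp (K * x₁) - w x₁)
        (min (w x₁ - η * Real.exp (-K * x₁)) (D x₁ - δ)) with h | h
      · left; linarith [h.symm.trans hzero]
      rcases min_choice (w x₁ - η * Real.exp (-K * x₁)) (D x₁ - δ) with h' | h'
      · right; left; linarith [(h'.symm.trans h.symm).trans hzero]
      · right; right; linarith [(h'.symm.trans h.symm).trans hzero]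
    rcases hcases with h | h | h
    · -- the upper barrier for `w`
      have h1 := P.abs_MD_le hw (g := fun s => C * Real.exp (K * s)) (by fun_prop) hx₁0.le
        fun s hs => by rw [abs_of_pos (hw0 s hs)]; exact hle1 s hs
      have h2 := integral_const_mul_exp_le hC0.le hK0 0 x₁
      have h3 : P.MD w x₁ ≤ P.lam * (1 + C / K * Real.exp (K * x₁)) := by
        refine (le_abs_self _).trans (h1.trans ?_)
        gcongr
      have h4 : P.lam * (C / K * Real.exp (K * x₁)) ≤ P.c / 4 * (C * Real.exp (K * x₁)) := by
        have : P.lam / K ≤ P.c / 4 := by rw [div_le_div_iff₀ hK0 (by norm_num)]; linarith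
        calc _ = P.lam / K * (C * Real.exp (K * x₁)) := by ring
          _ ≤ _ := by gcongr
      have h5 : 4 * P.lam ≤ P.c * w x₁ := by
        rw [h]
        calc 4 * P.lam ≤ C * P.c := hCl
          _ ≤ C * Real.exp (K * x₁) * P.c := by gcongr; exact hexp _ hx₁0.le
          _ = _ := by ring
      rw [← h] at h4
      -- Positivity of `D` forces this, whereas the two estimates before give `MD w ≤ c w / 2`.
      have h6 : P.c * w x₁ < P.MD w x₁ := by
        rw [hMDx]
        have : 0 < P.r * x₁ * w x₁ := by positivity
        linarith
      linarith
    · -- the lower barrier for `w`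
      have hd := hder.sub (hasDerivAt_const_mul_exp η (-K) x₁)
      have hd0 := deriv_nonpos_of_first_zero hd hx₁ε (by simp [h]) fun s hs => sub_pos.2 (hb2 s hs)
      have hd1 : P.rhs A w x₁ ≤ -(K * w x₁) := by rw [h]; linarith
      -- If `D` is large, `w'` cannot be as negative as `-K w`. If `D` is small, so is `MD w`, but
      -- the larger past values of `w` make `MD w` large.
      rcases le_or_gt ((P.c + P.r * x₁) * w x₁) (D x₁) with hsub | hsub
      · have hJ := neg_sq_div_le_J (E := k * x₁ * w x₁) hA hAa hDx
        have hcw : P.c * w x₁ ≤ D x₁ := by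
          have : 0 < P.r * x₁ * w x₁ := by positivity
          linarith
        have h2 : -(k ^ 2 * w x₁ ^ 2 / (2 * P.σ ^ 2 * D x₁)) ≤ P.rhs A w x₁ := by
          rw [hrhs]
          have := mul_le_mul_of_nonneg_left hJ (by positivity : 0 ≤ 2 / (P.σ ^ 2 * x₁ ^ 2))
          refine le_trans (le_of_eq ?_) this
          field_simp
          ring
        have h3 : k ^ 2 * w x₁ ^ 2 / (2 * P.σ ^ 2 * D x₁) ≤ k ^ 2 * w x₁ ^ 2 / (2 * P.σ ^ 2 * (P.c * w x₁)) := by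
          gcongr
        have h4 : k ^ 2 * w x₁ ^ 2 / (2 * P.σ ^ 2 * (P.c * w x₁)) < K * w x₁ := by
          rw [div_lt_iff₀ (by positivity)]
          have h5 := mul_lt_mul_of_pos_right hK2 (by positivity : 0 < w x₁ ^ 2)
          have h6 : 0 < k ^ 2 * w x₁ ^ 2 := by positivity
          linarith
        linarith
      · have hlow := le_MD (P := P) hw (p := x₁ - β) (q := x₁ - β / 2) (x := x₁)
          (m := η * Real.exp (-K * (x₁ - β / 2)))
          (by linarith) (by linarith) (by linarith) (fun s hs => (hw0 s hs).le) (by positivity)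
          (fun s hs => by
            refine le_trans ?_ (hle2 s ⟨by linarith [hs.1], by linarith [hs.2]⟩)
            gcongr η * ?_
            rw [Real.exp_le_exp, neg_mul, neg_mul, neg_le_neg_iff]
            gcongr
            exact hs.2)
          (fun s hs => hβt _ ⟨by linarith [hs.2], by linarith [hs.1]⟩)
        -- Moving back by `β/2` enlarges the barrier by a factor that grows with `K`.
        have he : η * Real.exp (-K * (x₁ - β / 2)) = Real.exp (K * β / 2) * w x₁ := by
          rw [h, mul_left_comm, ← Real.exp_add]
          congr 2
          ring
        rw [he] at hlow
        have hexpβ : K * β / 2 ≤ Real.exp (K * β / 2) := by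
          linarith [Real.add_one_le_exp (K * β / 2)]
        have h2 : P.MD w x₁ < 2 * (P.c + P.r * N) * w x₁ := by
          have : P.r * x₁ * w x₁ ≤ P.r * N * w x₁ := by gcongr
          linarith
        have h3 : P.lam * (β / 2 * (K * β / 2 * w x₁ / 2)) ≤ P.MD w x₁ := by
          refine le_trans ?_ hlow
          rw [show x₁ - β / 2 - (x₁ - β) = β / 2 by ring]
          gcongr
        have h4 := mul_le_mul_of_nonneg_right hK3 hwx.le
        linarith
    · -- the lower barrier for `D`
      have hd : HasDerivAt (fun x => D x - δ) _ x₁ := ((P.hasDerivAt_MD hw x₁).sub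
        ((((hasDerivAt_id' x₁).const_mul P.r).const_add P.c).mul hder)).sub_const δ
      have hd0 := deriv_nonpos_of_first_zero hd hx₁ε (by simp [h]) hb3
      have hwlx : wl ≤ w x₁ := by
        refine le_trans ?_ (hle2 x₁ ⟨hx₁0.le, le_rfl⟩)
        rw [hwl]
        gcongr η * ?_
        rw [Real.exp_le_exp, neg_mul, neg_mul, neg_le_neg_iff]
        gcongr
      have hwux : ∀ s ∈ Icc 0 x₁, w s ≤ wu := fun s hs => by
        refine (hle1 s hs).trans ?_
        rw [hwu]
        gcongr
        exact hs.2.trans hx₁N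
      -- At the level `δ` the test point `t` makes `w'` so negative that `D' > 0`, contrary to a
      -- first contact from above.
      have hE : 2 * D x₁ ≤ k * x₁ * w x₁ * t := by
        rw [h]
        refine hδt.trans ?_
        gcongr
      have hJ := J_le_neg_div hA hAab hAt hta hE
      have h1 : P.rhs A w x₁ ≤ -(k * wl / (P.σ ^ 2 * N * t)) := by
        rw [hrhs]
        calc _ ≤ 2 / (P.σ ^ 2 * x₁ ^ 2) * -(k * x₁ * w x₁ / (2 * t)) := by gcongr
          _ = -(k * w x₁ / (P.σ ^ 2 * x₁ * t)) := by field_simp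
          _ ≤ _ := by gcongr
      have h2 : Q < P.c * (k * wl / (P.σ ^ 2 * N * t)) := by
        rw [← mul_div_assoc, lt_div_iff₀ (by positivity)]
        linarith
      have h3 : P.c * (k * wl / (P.σ ^ 2 * N * t)) ≤ (P.c + P.r * x₁) * -P.rhs A w x₁ := by
        have : 0 ≤ P.r * x₁ := by positivity
        gcongr
        · linarith
        · linarith
      have h4 : |∫ s in (0 : ℝ)..x₁, w s * P.density (x₁ - s)| ≤ wu * f₁ * N := by
        rw [← Real.norm_eq_abs]
        refine (intervalIntegral.norm_integral_le_of_norm_le_const (C := wu * f₁)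
          fun s hs => ?_).trans ?_
        · rw [uIoc_of_le hx₁0.le] at hs
          rw [norm_mul, Real.norm_eq_abs, abs_of_pos (hw0 s ⟨hs.1.le, hs.2⟩)]
          have := hwux s ⟨hs.1.le, hs.2⟩
          have := hf₁' (x₁ - s) ⟨by linarith [hs.2], by linarith [hs.1]⟩
          gcongr
        · rw [sub_zero, abs_of_pos hx₁0]
          gcongr
      have h5 := hf₁' x₁ ⟨hx₁0.le, hx₁N⟩
      rw [Real.norm_eq_abs] at h5
      have h6 := mul_le_mul_of_nonneg_left (add_le_add (abs_le.1 h5).2 (abs_le.1 h4).2) hl.le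
      have h7 := mul_le_mul_of_nonneg_left (hwux x₁ ⟨hx₁0.le, le_rfl⟩) hr.le
      have h8 := mul_pos hl hwx
      linarith
  intro x hx
  have hx0 : 0 < x := by linarith [hx.1]
  obtain ⟨h1, h2⟩ := lt_min_iff.1 (key x hx)
  obtain ⟨h2, h3⟩ := lt_min_iff.1 h2
  have hwx : 0 < w x := by
    have : 0 < η * Real.exp (-K * x) := by positivity
    linarith
  refine ⟨hwx, by linarith, ?_⟩
  have hwux : w x ≤ wu := by
    refine (sub_pos.1 h1).le.trans ?_
    rw [hwu]
    gcongr
    exact hx.2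
  calc min t (2 * δ / (k * N * wu)) * (k * x * w x) ≤ 2 * δ / (k * N * wu) * (k * N * wu) := by
        gcongr
        · exact min_le_right _ _
        · exact hx.2
    _ = 2 * δ := by field_simp
    _ ≤ _ := by linarith

/-! ### Properties of `V_a`. -/

variable {P : Model} {Va : ℝ → ℝ}

open Classical in
/-- The derivative of `W` on `(0,∞)`, extended by the value `λ/c` on `(-∞,0]`. -/
noncomputable def derivExt (P : Model) (W : ℝ → ℝ) (x : ℝ) : ℝ :=
  if x ≤ 0 then P.lam / P.c else deriv W x

theorem derivExt_of_pos {W : ℝ → ℝ} {x : ℝ} (hx : 0 < x) : P.derivExt W x = deriv W x :=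
  if_neg (not_le.2 hx)

theorem derivExt_of_nonpos {W : ℝ → ℝ} {x : ℝ} (hx : x ≤ 0) : P.derivExt W x = P.lam / P.c :=
  if_pos hx

namespace IsVgamma

variable {γ : ℝ}

theorem hasDerivAt (h : P.IsVgamma γ Va) {x : ℝ} (hx : 0 < x) :
    HasDerivAt Va (P.derivExt Va x) x := by
  rw [derivExt_of_pos hx]
  exact ((h.contDiffOn.differentiableOn (by norm_num)).differentiableAt
    (Ioi_mem_nhds hx)).hasDerivAt

theorem contDiffOn_deriv (h : P.IsVgamma γ Va) : ContDiffOn ℝ 1 (deriv Va) (Ioi 0) := by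
  have h2 := h.contDiffOn
  rw [show (2 : WithTop ℕ∞) = 1 + 1 by norm_num,
    contDiffOn_succ_iff_deriv_of_isOpen isOpen_Ioi] at h2
  exact h2.2.2

theorem continuousOn_deriv_deriv (h : P.IsVgamma γ Va) :
    ContinuousOn (deriv (deriv Va)) (Ioi 0) := by
  have h2 := h.contDiffOn_deriv
  rw [show (1 : WithTop ℕ∞) = 0 + 1 by norm_num,
    contDiffOn_succ_iff_deriv_of_isOpen isOpen_Ioi] at h2
  exact h2.2.2.continuousOn

theorem hasDerivAt_derivExt (h : P.IsVgamma γ Va) {x : ℝ} (hx : 0 < x) :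
    HasDerivAt (P.derivExt Va) (deriv (deriv Va) x) x := by
  refine ((h.contDiffOn_deriv.differentiableOn (by norm_num)).differentiableAt
    (Ioi_mem_nhds hx)).hasDerivAt.congr_of_eventuallyEq ?_
  filter_upwards [Ioi_mem_nhds hx] with y hy using derivExt_of_pos hy

theorem continuous_derivExt (h : P.IsVgamma γ Va) : Continuous (P.derivExt Va) := by
  rw [continuous_iff_continuousAt]
  intro x
  rcases lt_trichotomy x 0 with hx | rfl | hx
  · exact continuousAt_const.congr (f := fun _ => P.lam / P.c)
      (by filter_upwards [Iio_mem_nhds hx] with y hy using (derivExt_of_nonpos (le_of_lt hy)).symm)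
  · rw [continuousAt_iff_continuous_left'_right']
    constructor
    · rw [ContinuousWithinAt, derivExt_of_nonpos le_rfl]
      exact tendsto_const_nhds.congr'
        (eventually_nhdsWithin_of_forall fun y hy => (derivExt_of_nonpos (le_of_lt hy)).symm)
    · rw [ContinuousWithinAt, derivExt_of_nonpos le_rfl]
      exact h.deriv_zero.congr'
        (eventually_nhdsWithin_of_forall fun y hy => (derivExt_of_pos hy).symm)
  · exact (h.hasDerivAt_derivExt hx).continuousAt

theorem eq_one_add_integral (h : P.IsVgamma γ Va) {x : ℝ} (hx : 0 < x) :
    Va x = 1 + ∫ s in (0 : ℝ)..x, P.derivExt Va s :=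
  Model.eq_one_add_integral h.continuous_derivExt (fun _ hy => h.hasDerivAt hy) h.zero hx

theorem M_eq (h : P.IsVgamma γ Va) {x : ℝ} (hx : 0 < x) : P.M Va x = P.MD (P.derivExt Va) x :=
  P.M_eq_MD h.continuous_derivExt hx fun _ hy => h.eq_one_add_integral hy.1

/-- At a first zero of `V'` the second derivative would be nonpositive, while the equation equates
its nonnegative multiple with `M > 0`. -/
theorem derivExt_pos (h : P.IsVgamma γ Va) (x : ℝ) : 0 < P.derivExt Va x := by
  have h0 : 0 < P.lam / P.c := div_pos P.lam_pos P.c_pos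
  rcases le_or_gt x 0 with hx | hx
  · rwa [derivExt_of_nonpos hx]
  by_contra hcon
  obtain ⟨y, hy, hzero, hpos⟩ := exists_first_zero (a := 0) (b := x)
    h.continuous_derivExt.continuousOn (by rwa [derivExt_of_nonpos le_rfl]) ⟨hx.le, le_rfl⟩
    (not_lt.1 hcon)
  have hd := deriv_nonpos_of_first_zero (h.hasDerivAt_derivExt hy.1) hy.1 hzero hpos
  have hM := MD_pos (P := P) h.continuous_derivExt hy.1 hpos
  have he := h.eqn y hy.1
  rw [L, h.M_eq hy.1, ← derivExt_of_pos (P := P) (W := Va) hy.1, hzero] at he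
  have : P.σ ^ 2 * y ^ 2 * γ ^ 2 / 2 * deriv (deriv Va) y ≤ 0 :=
    mul_nonpos_of_nonneg_of_nonpos (by positivity) hd
  linarith

/-- Near `0` the maximizer is `a`. -/
theorem exists_solvesHJBWith (h : P.IsVgamma P.a Va) (hμr : P.r < P.μ) :
    ∃ ε > 0, ∀ x ∈ Ioo 0 ε, P.SolvesHJBWith P.a Va x := by
  have ha := P.a_pos
  have hb := P.b_pos
  have hk : 0 < P.μ - P.r := sub_pos.2 hμr
  have hid : Tendsto (fun x : ℝ => x) (𝓝[>] 0) (𝓝 0) := tendsto_id.mono_left nhdsWithin_le_nhds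
  -- `𝓛^(a) - 𝓛^(θ)` is `x (a - θ)` times a cofactor; this expression bounds the cofactor from below
  -- for all `θ` at once.
  have hlim : Tendsto (fun x => (P.μ - P.r) * deriv Va x
      - P.σ ^ 2 * (2 * P.a + P.b) / 2 * (x * |deriv (deriv Va) x|)) (𝓝[>] 0)
      (𝓝 ((P.μ - P.r) * (P.lam / P.c))) := by
    have := (h.deriv_zero.const_mul (P.μ - P.r)).sub
      ((hid.mul h.deriv_deriv_zero.abs).const_mul (P.σ ^ 2 * (2 * P.a + P.b) / 2))
    simpa using this
  have hpos : 0 < (P.μ - P.r) * (P.lam / P.c) := mul_pos hk (div_pos P.lam_pos P.c_pos)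
  obtain ⟨ε, hε, hsub⟩ := mem_nhdsGT_iff_exists_Ioo_subset.1 (hlim.eventually (lt_mem_nhds hpos))
  refine ⟨ε, hε, fun x hx => ?_⟩
  have hx0 : 0 < x := hx.1
  have hE : 0 < (P.μ - P.r) * deriv Va x
      - P.σ ^ 2 * (2 * P.a + P.b) / 2 * (x * |deriv (deriv Va) x|) := hsub hx
  refine ⟨⟨by linarith, le_rfl⟩, fun θ hθ => ?_, h.eqn x hx0⟩
  simp only [mem_ofPred_eq, L]
  set z := deriv (deriv Va) x with hz
  have hθa : |θ + P.a| ≤ 2 * P.a + P.b :=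
    abs_le.2 ⟨by linarith [hθ.1], by linarith [hθ.2]⟩
  have h1 : -(|z| * (2 * P.a + P.b)) ≤ z * (θ + P.a) := by
    have : |z * (θ + P.a)| ≤ |z| * (2 * P.a + P.b) := by rw [abs_mul]; gcongr
    exact (abs_le.1 this).1
  have h2 := mul_le_mul_of_nonneg_left h1 (by positivity : 0 ≤ P.σ ^ 2 / 2 * x)
  have h3 : 0 ≤ x * (P.a - θ) * (P.σ ^ 2 / 2 * x * (z * (θ + P.a))
      + (P.μ - P.r) * deriv Va x) :=
    mul_nonneg (mul_nonneg hx0.le (by linarith [hθ.2])) (by linarith)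
  linarith

section

variable {ε : ℝ}

/-- The HJB inequality extends to the endpoint `ε`. -/
theorem hjb_le (h : P.IsVgamma P.a Va) (hε : 0 < ε)
    (hHJB : ∀ x ∈ Ioo 0 ε, P.SolvesHJBWith P.a Va x) {x : ℝ} (hx : x ∈ Ioc 0 ε) {θ : ℝ}
    (hθ : θ ∈ Icc (-P.b) P.a) :
    P.σ ^ 2 * x ^ 2 * deriv (deriv Va) x / 2 * θ ^ 2 + (P.μ - P.r) * x * P.derivExt Va x * θ
      - (P.MD (P.derivExt Va) x - (P.c + P.r * x) * P.derivExt Va x) ≤ 0 := by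
  have hw := h.continuous_derivExt
  have hM := P.continuous_MD hw
  set F : ℝ → ℝ := fun x => P.σ ^ 2 * x ^ 2 * deriv (deriv Va) x / 2 * θ ^ 2
      + (P.μ - P.r) * x * P.derivExt Va x * θ
      - (P.MD (P.derivExt Va) x - (P.c + P.r * x) * P.derivExt Va x) with hF
  have hle : ∀ y ∈ Ioo 0 ε, F y ≤ 0 := by
    intro y hy
    have h1 := (hHJB y hy).2
    have h2 : P.L θ Va y ≤ P.L P.a Va y := h1.1 hθ
    rw [h1.2, L_eq, h.M_eq hy.1, ← derivExt_of_pos (P := P) (W := Va) hy.1] at h2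
    exact h2
  rcases hx.2.lt_or_eq with hlt | rfl
  · exact hle x ⟨hx.1, hlt⟩
  have hc : ContinuousAt F x := by
    have hz := h.continuousOn_deriv_deriv.continuousAt (Ioi_mem_nhds hx.1)
    simp only [hF]
    fun_prop
  refine le_of_tendsto (hc.tendsto.mono_left (nhdsWithin_le_nhds (s := Iio x))) ?_
  filter_upwards [Ioo_mem_nhdsLT hx.1] with y hy using hle y hy

theorem hjb_eq (h : P.IsVgamma P.a Va) {x : ℝ} (hx : 0 < x) :
    P.σ ^ 2 * x ^ 2 * deriv (deriv Va) x / 2 * P.a ^ 2 + (P.μ - P.r) * x * P.derivExt Va x * P.a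
      - (P.MD (P.derivExt Va) x - (P.c + P.r * x) * P.derivExt Va x) = 0 := by
  have := h.eqn x hx
  rwa [L_eq, h.M_eq hx, ← derivExt_of_pos (P := P) (W := Va) hx] at this

theorem isHJBValue (h : P.IsVgamma P.a Va) (hε : 0 < ε)
    (hHJB : ∀ x ∈ Ioo 0 ε, P.SolvesHJBWith P.a Va x) {x : ℝ} (hx : x ∈ Ioc 0 ε) :
    P.IsHJBValue (P.MD (P.derivExt Va) x - (P.c + P.r * x) * P.derivExt Va x)
      ((P.μ - P.r) * x * P.derivExt Va x) (P.σ ^ 2 * x ^ 2 * deriv (deriv Va) x / 2) :=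
  ⟨fun _ hθ => h.hjb_le hε hHJB hx hθ,
    P.a, ⟨by linarith [P.a_pos, P.b_pos], le_rfl⟩, h.hjb_eq hx.1⟩

/-- If `D ≤ 0`, the HJB inequality at `a` forces `z < 0` with vertex `E/(-2z)` in `(0,a]`, and the
value at the vertex is then positive. -/
theorem numerator_pos (h : P.IsVgamma P.a Va) (hμr : P.r < P.μ) (hε : 0 < ε)
    (hHJB : ∀ x ∈ Ioo 0 ε, P.SolvesHJBWith P.a Va x) {x : ℝ} (hx : x ∈ Ioc 0 ε) :
    0 < P.MD (P.derivExt Va) x - (P.c + P.r * x) * P.derivExt Va x := by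
  have ha := P.a_pos
  have hb := P.b_pos
  have hE : 0 < (P.μ - P.r) * x * P.derivExt Va x :=
    mul_pos (mul_pos (sub_pos.2 hμr) hx.1) (h.derivExt_pos x)
  have hle := fun θ hθ => (h.isHJBValue hε hHJB hx).1 θ hθ
  set D := P.MD (P.derivExt Va) x - (P.c + P.r * x) * P.derivExt Va x
  set E := (P.μ - P.r) * x * P.derivExt Va x
  set z := P.σ ^ 2 * x ^ 2 * deriv (deriv Va) x / 2
  by_contra hcon
  have h1 := hle P.a ⟨by linarith, le_rfl⟩
  have hza : z * P.a ≤ -E := by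
    have : (z * P.a + E) * P.a ≤ 0 := by linarith
    linarith [nonpos_of_mul_nonpos_left this ha]
  have hz : z < 0 := by
    by_contra hz
    have := mul_nonneg (not_lt.1 hz) ha.le
    linarith
  have hθ0 : 0 < E / (-2 * z) := div_pos hE (by linarith)
  have h2 := hle (E / (-2 * z)) ⟨by linarith, by
    rw [div_le_iff₀ (by linarith)]
    linarith⟩
  have h3 : z * (E / (-2 * z)) ^ 2 + E * (E / (-2 * z)) = E / 2 * (E / (-2 * z)) := by
    field_simp
    ring
  have : 0 < E / 2 * (E / (-2 * z)) := by positivity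
  linarith

/-- The maximizer `a` survives the cut-off, so `V_a'` solves every truncated equation on `(0,ε]`. -/
theorem deriv_deriv_eq_rhs (h : P.IsVgamma P.a Va) (hε : 0 < ε)
    (hHJB : ∀ x ∈ Ioo 0 ε, P.SolvesHJBWith P.a Va x) {x : ℝ} (hx : x ∈ Ioc 0 ε) {A : ℝ}
    (hA : 0 < A) (hA' : A < min P.a P.b) :
    deriv (deriv Va) x = P.rhs A (P.derivExt Va) x := by
  have hJ := J_eq (θ₀ := P.a) hA hA' (fun θ hθ => h.hjb_le hε hHJB hx hθ)
    ⟨by linarith [P.a_pos, P.b_pos], le_rfl⟩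
    (by rw [abs_of_pos P.a_pos]; exact (lt_min_iff.1 hA').1.le) (h.hjb_eq hx.1)
  rw [rhs, hJ]
  have := P.σ_pos
  have := hx.1
  field_simp

end

end IsVgamma

/-! ### Gluing at `ε` and independence of the cut-off. -/

theorem rhs_congr {A : ℝ} {u v : ℝ → ℝ} {x : ℝ} (hx : 0 ≤ x) (h : ∀ s ∈ Icc 0 x, u s = v s) :
    P.rhs A u x = P.rhs A v x := by
  rw [rhs, rhs, P.MD_congr hx h, h x ⟨hx, le_rfl⟩]

theorem extend_eq (h : P.IsVgamma P.a Va) {ε : ℝ} (hε : 0 < ε) {w u : ℝ → ℝ} (hu : Continuous u)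
    (hu1 : ∀ x ≤ ε, u x = P.derivExt Va x) (hu2 : ∀ x, ε ≤ x → u x = w x) {x : ℝ} (hx : 0 < x) :
    extend Va ε w x = 1 + ∫ s in (0 : ℝ)..x, u s := by
  have hVa : ∀ y ∈ Ioc 0 ε, Va y = 1 + ∫ s in (0 : ℝ)..y, u s := by
    intro y hy
    rw [h.eq_one_add_integral hy.1]
    congr 1
    refine intervalIntegral.integral_congr fun s hs => ?_
    rw [uIcc_of_le hy.1.le] at hs
    exact (hu1 s (hs.2.trans hy.2)).symm
  unfold extend
  split_ifs with hxε
  · exact hVa x ⟨hx, hxε⟩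
  · push Not at hxε
    rw [hVa ε ⟨hε, le_rfl⟩, ← intervalIntegral.integral_add_adjacent_intervals
      (hu.intervalIntegrable 0 ε) (hu.intervalIntegrable ε x), add_assoc]
    congr 2
    refine intervalIntegral.integral_congr fun s hs => ?_
    rw [uIcc_of_le hxε.le] at hs
    exact (hu2 s hs.1).symm

theorem T_eq_rhs (h : P.IsVgamma P.a Va) {ε A : ℝ} (hε : 0 < ε) (hA : 0 < A) {w u : ℝ → ℝ}
    (hu : Continuous u) (hu1 : ∀ x ≤ ε, u x = P.derivExt Va x) (hu2 : ∀ x, ε ≤ x → u x = w x)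
    {x : ℝ} (hx : ε ≤ x) : P.T A Va ε w x = P.rhs A u x := by
  rw [T_eq_J hA, rhs, P.M_eq_MD hu (hε.trans_le hx) fun y hy => extend_eq h hε hu hu1 hu2 hy.1,
    hu2 x hx]

/-- A solution of the truncated equation beyond `ε`, glued to `V_a'`, solves the equation on
`(0,∞)`. -/
theorem SolvesT.exists_glued (h : P.IsVgamma P.a Va) {ε A : ℝ} (hε : 0 < ε)
    (hHJB : ∀ x ∈ Ioo 0 ε, P.SolvesHJBWith P.a Va x) (hA : 0 < A) (hA' : A < min P.a P.b)
    {w : ℝ → ℝ} (hw : P.SolvesT A Va ε w) :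
    ∃ u, Continuous u ∧ (∀ x ≤ ε, u x = P.derivExt Va x) ∧
      (∀ x, 0 < x → HasDerivAt u (P.rhs A u x) x) ∧
      ∀ x, 0 < x → extend Va ε w x = 1 + ∫ s in (0 : ℝ)..x, u s := by
  have hwc : ContinuousOn w (Ici ε) := fun x hx => (hw.2 x hx).continuousWithinAt
  -- The bracket vanishes on the left of `ε`; on the right `w ε = V_a'(ε)` leaves `w`. The one-sided
  -- derivatives at `ε` agree because both are given by `rhs`.
  set u : ℝ → ℝ := fun x => P.derivExt Va (min x ε) + (w (max x ε) - w ε) with hudef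
  have hu : Continuous u := by
    have h1 := h.continuous_derivExt
    have h2 : Continuous fun x => w (max x ε) :=
      hwc.comp_continuous (by fun_prop) fun x => mem_Ici.2 (le_max_right _ _)
    exact (h1.comp (continuous_id.min continuous_const)).add (h2.sub continuous_const)
  have hu1 : ∀ x ≤ ε, u x = P.derivExt Va x := fun x hx => by simp [hudef, hx]
  have hu2 : ∀ x, ε ≤ x → u x = w x := fun x hx => by
    simp [hudef, hx, derivExt_of_pos hε, hw.1]
  have hright : ∀ x, ε ≤ x → HasDerivWithinAt u (P.rhs A u x) (Ici ε) x := fun x hx => by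
    have := hw.2 x hx
    rw [T_eq_rhs h hε hA hu hu1 hu2 hx] at this
    exact this.congr hu2 (hu2 x hx)
  have hleft : ∀ x ∈ Ioc 0 ε, HasDerivWithinAt u (P.rhs A u x) (Iic ε) x := fun x hx => by
    rw [rhs_congr hx.1.le fun s hs => hu1 s (hs.2.trans hx.2),
      ← h.deriv_deriv_eq_rhs hε hHJB hx hA hA']
    exact (h.hasDerivAt_derivExt hx.1).hasDerivWithinAt.congr hu1 (hu1 x hx.2)
  refine ⟨u, hu, hu1, fun x hx => ?_, fun x hx => extend_eq h hε hu hu1 hu2 hx⟩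
  rcases lt_trichotomy x ε with hlt | rfl | hgt
  · exact (hleft x ⟨hx, hlt.le⟩).hasDerivAt (Iic_mem_nhds hlt)
  · have := (hleft x ⟨hx, le_rfl⟩).union (hright x le_rfl)
    rwa [Iic_union_Ici, hasDerivWithinAt_univ] at this
  · exact (hright x hgt.le).hasDerivAt (Ici_mem_nhds hgt)

theorem exists_solvesT (h : P.IsVgamma P.a Va) (hμr : P.r < P.μ) {ε A : ℝ} (hε : 0 < ε)
    (hA : 0 < A) (hA' : A < P.a) : ∃ w, P.SolvesT A Va ε w := by
  obtain ⟨B, hB⟩ := isCompact_Icc.exists_bound_of_continuousOn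
    (h.continuous_derivExt.continuousOn (s := Icc 0 ε))
  obtain ⟨w, hw, hw1, hw2⟩ := exists_solution hμr hA hA' hε h.continuous_derivExt
    ⟨B, fun x hx => by
      rcases le_or_gt x 0 with h0 | h0
      · rw [derivExt_of_nonpos h0, ← derivExt_of_nonpos (W := Va) le_rfl]
        exact hB 0 ⟨le_rfl, hε.le⟩
      · exact hB x ⟨h0.le, hx⟩⟩
  refine ⟨w, by rw [hw1 ε le_rfl, derivExt_of_pos hε], fun x hx => ?_⟩
  rw [T_eq_rhs h hε hA hw hw1 (fun _ _ => rfl) hx]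
  exact hw2 x hx

/-- On bounded intervals the glued solutions do not depend on the cut-off level, provided it is
small enough. -/
theorem exists_stable (h : P.IsVgamma P.a Va) (hμr : P.r < P.μ) {ε : ℝ} (hε : 0 < ε)
    (hHJB : ∀ x ∈ Ioo 0 ε, P.SolvesHJBWith P.a Va x) {u : ℕ → ℝ → ℝ}
    (hu : ∀ n, 2 ≤ n → Continuous (u n)) (hu1 : ∀ n, 2 ≤ n → ∀ x ≤ ε, u n x = P.derivExt Va x)
    (hu2 : ∀ n : ℕ, 2 ≤ n → ∀ x, 0 < x →
      HasDerivAt (u n) (P.rhs (min P.a P.b / n) (u n) x) x) {N : ℝ} (hN : ε ≤ N) :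
    ∃ n₀, 2 ≤ n₀ ∧ (∀ n ≥ n₀, ∀ x ∈ Icc 0 N, u n x = u n₀ x) ∧
      ∀ x ∈ Ioc 0 N, 0 < u n₀ x ∧ 0 < P.MD (u n₀) x - (P.c + P.r * x) * u n₀ x ∧
        P.IsHJBValue (P.MD (u n₀) x - (P.c + P.r * x) * u n₀ x) ((P.μ - P.r) * x * u n₀ x)
          (P.σ ^ 2 * x ^ 2 * P.rhs (min P.a P.b / n₀) (u n₀) x / 2) := by
  have hab0 : 0 < min P.a P.b := lt_min P.a_pos P.b_pos
  have hs := P.σ_pos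
  have hk : 0 < P.μ - P.r := sub_pos.2 hμr
  have hA : ∀ n : ℕ, 2 ≤ n → 0 < min P.a P.b / n := fun n hn => by
    have : 0 < n := by lia
    positivity
  have hA' : ∀ n : ℕ, 2 ≤ n → min P.a P.b / n < min P.a P.b := fun n hn =>
    div_lt_self hab0 (by exact_mod_cast hn)
  obtain ⟨A₀, hA₀, hbound⟩ := exists_apriori_bound (P := P) hμr h.continuous_derivExt hε hN
    (fun x _ => h.derivExt_pos x) (h.numerator_pos hμr hε hHJB ⟨hε, le_rfl⟩)
  obtain ⟨n₁, hn₁⟩ := exists_nat_ge (min P.a P.b / A₀)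
  have hsmall : ∀ n : ℕ, max 2 n₁ ≤ n → min P.a P.b / n ≤ A₀ := fun n hn => by
    have h2 : 0 < n := by have := le_max_left 2 n₁; lia
    have h3 : (n₁ : ℝ) ≤ n := by exact_mod_cast (le_max_right 2 n₁).trans hn
    rw [div_le_iff₀ (by positivity)]
    rw [div_le_iff₀ hA₀] at hn₁
    nlinarith
  have hb : ∀ n, max 2 n₁ ≤ n → ∀ x ∈ Icc ε N, _ := fun n hn =>
    have hn2 : 2 ≤ n := (le_max_left _ _).trans hn
    hbound _ (hA n hn2) (hsmall n hn) (hA' n hn2) (u n) (hu n hn2)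
      (fun x hx => hu1 n hn2 x hx.2) (fun x hx => hu2 n hn2 x (hε.trans hx))
  set m := max 2 n₁ with hm
  have hm2 : 2 ≤ m := le_max_left _ _
  -- Level `n` fixes the solution, level `j` the cut-off in `J`: the bounds let every small cut-off
  -- compute the genuine HJB value along every solution.
  have hval : ∀ n, m ≤ n → ∀ j, m ≤ j → ∀ x ∈ Icc ε N,
      P.IsHJBValue (P.MD (u n) x - (P.c + P.r * x) * u n x) ((P.μ - P.r) * x * u n x)
        (P.J (min P.a P.b / j) (P.MD (u n) x - (P.c + P.r * x) * u n x)
          ((P.μ - P.r) * x * u n x)) := by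
    intro n hn j hj x hx
    obtain ⟨h1, h2, h3⟩ := hb n hn x hx
    have hx0 : 0 < x := hε.trans_le hx.1
    have hE : 0 < (P.μ - P.r) * x * u n x := by positivity
    exact isHJBValue_J (hA j (hm2.trans hj)) (hA' j (hm2.trans hj)) h2 hE
      ((mul_le_mul_of_nonneg_right (hsmall j hj) hE.le).trans h3)
  refine ⟨m, hm2, fun n hn => ?_, fun x hx => ?_⟩
  · refine eqOn_of_solutions hμr (hA m hm2) ((hA' m hm2).trans_le (min_le_left _ _)) hε hN
      (hu n (hm2.trans hn)) (hu m hm2)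
      (fun x hx => by rw [hu1 n (hm2.trans hn) x hx.2, hu1 m hm2 x hx.2])
      (fun x hx => ?_) fun x hx => (hu2 m hm2 x (hε.trans_le hx.1)).hasDerivWithinAt
    have hx' : x ∈ Icc ε N := ⟨hx.1, hx.2.le⟩
    -- Both sides come from the unique HJB value, so `u n` solves the equation of level `m`.
    have he : P.rhs (min P.a P.b / m) (u n) x = P.rhs (min P.a P.b / n) (u n) x := by
      rw [rhs, rhs, (hval n hn m le_rfl x hx').unique (hb n hn x hx').2.1 (hval n hn n hn x hx')]
    rw [he]
    exact (hu2 n (hm2.trans hn) x (hε.trans_le hx.1)).hasDerivWithinAt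
  · have hx0 := hx.1
    rcases le_or_gt x ε with hxε | hxε
    · have hcong : ∀ s ∈ Icc 0 x, u m s = P.derivExt Va s := fun s hs =>
        hu1 m hm2 s (hs.2.trans hxε)
      rw [rhs_congr hx0.le hcong, P.MD_congr hx0.le hcong, hu1 m hm2 x hxε,
        ← h.deriv_deriv_eq_rhs hε hHJB ⟨hx0, hxε⟩ (hA m hm2) (hA' m hm2)]
      exact ⟨h.derivExt_pos x, h.numerator_pos hμr hε hHJB ⟨hx0, hxε⟩,
        h.isHJBValue hε hHJB ⟨hx0, hxε⟩⟩
    · have hx' : x ∈ Icc ε N := ⟨hxε.le, hx.2⟩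
      obtain ⟨h1, h2, -⟩ := hb m le_rfl x hx'
      refine ⟨h1, h2, ?_⟩
      convert hval m le_rfl m le_rfl x hx' using 1
      rw [rhs]
      field_simp

theorem tendsto_extend {ε : ℝ} {w u : ℕ → ℝ → ℝ}
    (he : ∀ n, 2 ≤ n → ∀ x, 0 < x → extend Va ε (w n) x = 1 + ∫ s in (0 : ℝ)..x, u n s)
    {n₀ : ℕ} (hn₀ : 2 ≤ n₀) {N : ℝ} (heq : ∀ n ≥ n₀, ∀ x ∈ Icc 0 N, u n x = u n₀ x)
    {x : ℝ} (hx : x ∈ Ioc 0 N) :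
    Tendsto (fun n => extend Va ε (w n) x) atTop (𝓝 (1 + ∫ s in (0 : ℝ)..x, u n₀ s)) := by
  refine tendsto_const_nhds.congr' ?_
  filter_upwards [eventually_ge_atTop n₀] with n hn
  rw [he n (hn₀.trans hn) x hx.1]
  congr 1
  refine intervalIntegral.integral_congr fun s hs => ?_
  rw [uIcc_of_le hx.1.le] at hs
  exact (heq n hn s ⟨hs.1, hs.2.trans hx.2⟩).symm

/-! ### The limit `V` and the conclusion. -/

theorem exists_isV (P : Model) (hμr : P.r < P.μ) : ∃ V, P.IsV V := by
  have hab0 : 0 < min P.a P.b := lt_min P.a_pos P.b_pos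
  have hA : ∀ n : ℕ, 2 ≤ n → 0 < min P.a P.b / n := fun n hn => by
    have : 0 < n := by lia
    positivity
  have hA' : ∀ n : ℕ, 2 ≤ n → min P.a P.b / n < min P.a P.b := fun n hn =>
    div_lt_self hab0 (by exact_mod_cast hn)
  obtain ⟨Va, hVa⟩ := P.exists_isVgamma hμr P.a_pos
  obtain ⟨ε, hε, hHJB⟩ := hVa.exists_solvesHJBWith hμr
  have hw : ∀ n : ℕ, ∃ w, 2 ≤ n → P.SolvesT (min P.a P.b / n) Va ε w := fun n => by
    by_cases hn : 2 ≤ n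
    · obtain ⟨w, hw⟩ := exists_solvesT hVa hμr hε (hA n hn)
        ((hA' n hn).trans_le (min_le_left _ _))
      exact ⟨w, fun _ => hw⟩
    -- Indices below `2` carry no condition, and any function will do.
    · exact ⟨0, fun h => absurd h hn⟩
  choose w hw using hw
  have hu : ∀ n : ℕ, ∃ u : ℝ → ℝ, 2 ≤ n → _ := fun n => by
    by_cases hn : 2 ≤ n
    · obtain ⟨u, hu⟩ := (hw n hn).exists_glued hVa hε hHJB (hA n hn) (hA' n hn)
      exact ⟨u, fun _ => hu⟩
    · exact ⟨0, fun h => absurd h hn⟩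
  choose u hu using hu
  have hlim : ∀ x : ℝ, ∃ l, 0 < x → Tendsto (fun n => extend Va ε (w n) x) atTop (𝓝 l) := by
    intro x
    obtain ⟨n₀, hn₀, heq, -⟩ := exists_stable hVa hμr hε hHJB (fun n hn => (hu n hn).1)
      (fun n hn => (hu n hn).2.1) (fun n hn => (hu n hn).2.2.1) (le_max_right x ε)
    exact ⟨_, fun hx => tendsto_extend (fun n hn => (hu n hn).2.2.2) hn₀ heq
      ⟨hx, le_max_left x ε⟩⟩
  choose V hV using hlim
  exact ⟨V, Va, ε, w, hVa, hε, hHJB, hw, hV⟩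

/-- The local structure of `V`. -/
theorem IsV.exists_local {V : ℝ → ℝ} (hV : P.IsV V) (hμr : P.r < P.μ) (N : ℝ) :
    ∃ (A : ℝ) (u : ℝ → ℝ), 0 < A ∧ A < P.a ∧ Continuous u ∧ ∀ x ∈ Ioo 0 N,
      HasDerivAt V (u x) x ∧ HasDerivAt u (P.rhs A u x) x ∧ P.M V x = P.MD u x ∧
      0 < u x ∧ 0 < P.MD u x - (P.c + P.r * x) * u x ∧
      P.IsHJBValue (P.MD u x - (P.c + P.r * x) * u x) ((P.μ - P.r) * x * u x)
        (P.σ ^ 2 * x ^ 2 * P.rhs A u x / 2) := by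
  obtain ⟨Va, ε, w, hVa, hε, hHJB, hw, hlim⟩ := hV
  have hab0 : 0 < min P.a P.b := lt_min P.a_pos P.b_pos
  have hA : ∀ n : ℕ, 2 ≤ n → 0 < min P.a P.b / n := fun n hn => by
    have : 0 < n := by lia
    positivity
  have hA' : ∀ n : ℕ, 2 ≤ n → min P.a P.b / n < min P.a P.b := fun n hn =>
    div_lt_self hab0 (by exact_mod_cast hn)
  have hu : ∀ n : ℕ, ∃ u : ℝ → ℝ, 2 ≤ n → _ := fun n => by
    by_cases hn : 2 ≤ n
    · obtain ⟨u, hu⟩ := (hw n hn).exists_glued hVa hε hHJB (hA n hn) (hA' n hn)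
      exact ⟨u, fun _ => hu⟩
    · exact ⟨0, fun h => absurd h hn⟩
  choose u hu using hu
  obtain ⟨n₀, hn₀, heq, hprop⟩ := exists_stable hVa hμr hε hHJB (fun n hn => (hu n hn).1)
    (fun n hn => (hu n hn).2.1) (fun n hn => (hu n hn).2.2.1) (le_max_right N ε)
  have hVeq : ∀ x ∈ Ioo 0 N, V x = 1 + ∫ s in (0 : ℝ)..x, u n₀ s := fun x hx =>
    tendsto_nhds_unique (hlim x hx.1) (tendsto_extend (fun n hn => (hu n hn).2.2.2) hn₀ heq
      ⟨hx.1, hx.2.le.trans (le_max_left N ε)⟩)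
  refine ⟨min P.a P.b / n₀, u n₀, hA n₀ hn₀, (hA' n₀ hn₀).trans_le (min_le_left _ _),
    (hu n₀ hn₀).1, fun x hx => ⟨?_, (hu n₀ hn₀).2.2.1 x hx.1, ?_,
    hprop x ⟨hx.1, hx.2.le.trans (le_max_left N ε)⟩⟩⟩
  · refine (((hu n₀ hn₀).1.integral_hasStrictDerivAt 0 x).hasDerivAt.const_add
      1).congr_of_eventuallyEq ?_
    filter_upwards [Ioo_mem_nhds hx.1 hx.2] with y hy using hVeq y hy
  · exact P.M_eq_MD (hu n₀ hn₀).1 hx.1 fun y hy => hVeq y ⟨hy.1, hy.2.trans_lt hx.2⟩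

theorem IsV.contDiffOn {V : ℝ → ℝ} (hV : P.IsV V) (hμr : P.r < P.μ) :
    ContDiffOn ℝ 2 V (Ioi 0) := by
  have key : ∀ x : ℝ, 0 < x → HasDerivAt V (deriv V x) x ∧
      HasDerivAt (deriv V) (deriv (deriv V) x) x ∧ ContinuousAt (deriv (deriv V)) x := by
    intro x hx
    -- The bound `x + 1` makes `x` interior, so that the local description can be differentiated
    -- there.
    obtain ⟨A, u, hA, hA', hu, h⟩ := hV.exists_local hμr (x + 1)
    have hmem : Ioo 0 (x + 1) ∈ 𝓝 x := Ioo_mem_nhds hx (by linarith)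
    have e1 : ∀ y ∈ Ioo 0 (x + 1), deriv V y = u y := fun y hy => (h y hy).1.deriv
    have e2 : ∀ y ∈ Ioo 0 (x + 1), HasDerivAt (deriv V) (P.rhs A u y) y := fun y hy =>
      (h y hy).2.1.congr_of_eventuallyEq
        (by filter_upwards [Ioo_mem_nhds hy.1 hy.2] with z hz using e1 z hz)
    have hxm : x ∈ Ioo 0 (x + 1) := ⟨hx, by linarith⟩
    refine ⟨(h x hxm).1.differentiableAt.hasDerivAt, (e2 x hxm).differentiableAt.hasDerivAt, ?_⟩
    refine ((continuousOn_rhs hA hA' hu).continuousAt (Ioi_mem_nhds hx)).congr ?_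
    filter_upwards [hmem] with y hy using (e2 y hy).deriv.symm
  exact contDiffOn_two_of_hasDerivAt (fun x hx => (key x hx).1) (fun x hx => (key x hx).2.1)
    fun x hx => (key x hx).2.2.continuousWithinAt

theorem IsV.isHJBValue {V : ℝ → ℝ} (hV : P.IsV V) (hμr : P.r < P.μ) {x : ℝ} (hx : 0 < x) :
    0 < deriv V x ∧ 0 < P.M V x - (P.c + P.r * x) * deriv V x ∧
      P.IsHJBValue (P.M V x - (P.c + P.r * x) * deriv V x) ((P.μ - P.r) * x * deriv V x)
        (P.σ ^ 2 * x ^ 2 * deriv (deriv V) x / 2) := by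
  obtain ⟨A, u, hA, hA', hu, h⟩ := hV.exists_local hμr (x + 1)
  have hxm : x ∈ Ioo 0 (x + 1) := ⟨hx, by linarith⟩
  have e2 : HasDerivAt (deriv V) (P.rhs A u x) x :=
    (h x hxm).2.1.congr_of_eventuallyEq
      (by filter_upwards [Ioo_mem_nhds hxm.1 hxm.2] with z hz using (h z hz).1.deriv)
  obtain ⟨h1, -, h3, h4⟩ := h x hxm
  rw [e2.deriv, h1.deriv, h3]
  exact h4

end Model

end ConstrainedInvestment

theorem mainTheorem3 (P : ConstrainedInvestment.Model) (hμr : P.r < P.μ) (hab : P.a < P.b) :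
    (∃ V : ℝ → ℝ, P.IsV V) ∧
    ∀ V : ℝ → ℝ, P.IsV V →
      ContDiffOn ℝ 2 V (Set.Ioi 0) ∧
      (∀ x, 0 < x → 0 < deriv V x) ∧
      -- part (i)
      (∀ x, 0 < x → P.phi V x < P.a →
        deriv (deriv V) x ≠ 0 ∧ P.SolvesHJBWith (P.alpha V x) V x) ∧
      (∀ x, 0 < x → P.a < P.phi V x → P.phi V x < 2 * P.a * P.b / (P.b - P.a) →
        P.SolvesHJBWith P.a V x) ∧
      (∀ x, 0 < x → 2 * P.a * P.b / (P.b - P.a) < P.phi V x →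
        P.SolvesHJBWith (-P.b) V x) ∧
      -- part (ii)
      (∀ x, 0 < x → P.SolvesHJBWith (P.alphaStar V x) V x) ∧
      (∀ x, 0 < x → P.phi V x < P.a →
        P.alphaStar V x = P.alpha V x ∧ P.alpha V x = P.phi V x) ∧
      (∀ x, 0 < x → P.a ≤ P.phi V x → P.phi V x ≤ 2 * P.a * P.b / (P.b - P.a) →
        P.alphaStar V x = P.a) ∧
      (∀ x, 0 < x → 2 * P.a * P.b / (P.b - P.a) < P.phi V x →
        P.alphaStar V x = -P.b) ∧
      (∀ x, 0 < x → 0 < P.phi V x) := by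
  refine ⟨P.exists_isV hμr, fun V hV => ?_⟩
  have hval := fun x (hx : 0 < x) => hV.isHJBValue hμr hx
  have hmax := fun x (hx : 0 < x) =>
    (hval x hx).2.2.maximizer hμr hab hx (hval x hx).1 (hval x hx).2.1
  refine ⟨hV.contDiffOn hμr, fun x hx => (hval x hx).1,
    fun x hx h => ⟨((hmax x hx).1 h).1, ((hmax x hx).1 h).2.1⟩,
    fun x hx h1 h2 => ((hmax x hx).2.1 h1.le h2.le).1,
    fun x hx h => ((hmax x hx).2.2.1 h).1, fun x hx => ?_,
    fun x hx h => ((hmax x hx).1 h).2.2, fun x hx h1 h2 => ((hmax x hx).2.1 h1 h2).2,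
    fun x hx h => ((hmax x hx).2.2.1 h).2, fun x hx => (hmax x hx).2.2.2⟩
  rcases lt_or_ge (P.phi V x) P.a with h1 | h1
  · have h := (hmax x hx).1 h1
    rw [h.2.2.1]
    exact h.2.1
  rcases le_or_gt (P.phi V x) (2 * P.a * P.b / (P.b - P.a)) with h2 | h2
  · have h := (hmax x hx).2.1 h1 h2
    rw [h.2]
    exact h.1
  · have h := (hmax x hx).2.2.1 h2
    rw [h.2]
    exact h.1
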